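/- **Setting.** Let $O_i=(Y_i,Z_i,X^*_{i1},\dots,X^*_{ik})$, $i=1,2,\dots$, be independent with common law $P$, where the $X^*_{ij}\in\mathbb R^p$ are proxies of an unobserved covariate. Let $\xi$ be a vector of correction parameters whose components include vectors $\eta_{0j},\eta_{1j}\in\mathbb R^p$, symmetric matrices $M_j\in\mathbb R^{p\times p}$ and weights $\alpha_j\in\mathbb R$ $(j=1,\dots,k)$, and possibly further parameters. The estimator $\widehat\xi$ lies in a compact set $\Xi$ and solves $n^{-1}\sum_{i=1}^n g(O_i,\widehat\xi)=0$; the population value, also denoted $\xi$, is the unique root in $\Xi$ of $E\{g(O,\cdot)\}=0$. Fix $B\ge 1$, a grid $0\le\lambda_1<\dots<\lambda_R$, an estimating function $\psi(y,z,x,\Theta)\in\mathbb R^d$ with $\Theta\in\mathbb R^d$, and an extrapolant $\mathcal G(\lambda,\Gamma)\in\mathbb R^d$ with $\Gamma\in\mathbb R^m$. Writing $\circ$ and $\eta^{-1}$ for the entrywise product and inverse and $\nu$ for simulated standard normal vectors, independent over subjects, replicates $b$ and proxies $j$, independent of the data and common to all $\lambda$, the simulated covariates are $$\text{(before)}\quad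 X^*_{bi}(\lambda)=\eta_{1\cdot}^{-1}\circ\bigl(\textstyle\sum_j\alpha_jX^*_{ij}-\eta_{0\cdot}+\lambda^{1/2}M_*^{1/2}\nu_{bi}\bigr),\qquad \eta_{l\cdot}=\sum_j\alpha_j\eta_{lj}\ (l=0,1),\quad M_*=\sum_j\alpha_j^2M_j,$$ $$\text{(after)}\quad X^*_{bij}(\lambda)=\eta_{1j}^{-1}\circ\bigl(X^*_{ij}-\eta_{0j}+\lambda^{1/2}M_j^{1/2}\nu_{bij}\bigr),\qquad j=1,\dots,k.$$ In the first case put $S=\{1\}$ (one series of simulated covariates), in the second $S=\{1,\dots,k\}$. For each series $s\in S$: $\widehat\Theta^{(s)}_{b,\lambda}$ lies in a compact set $T$ and solves $n^{-1}\sum_i\psi(Y_i,Z_i,X^{*}_{b,i,s}(\lambda),\Theta)=0$, with $\widehat\xi$ plugged in for $\xi$; $\widehat\Theta^{(s)}_\lambda=B^{-1}\sum_b\widehat\Theta^{(s)}_{b,\lambda}$; and $\widehat\Gamma_s$ minimizes $R_s(\Gamma)^{\mathsf T}C_s^{-1}R_s(\Gamma)$ over a set $\mathcal S\subset\mathbb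 R^m$, where $R_s(\Gamma)=(\widehat\Theta^{(s)}_{\lambda_r}-\mathcal G(\lambda_r,\Gamma))_{r=1}^R$ and $C_s$ is a given positive definite matrix. (All three requirements need to hold only with probability tending to one.) The SIMEX estimators are $$\text{(before)}\ \ \widehat\Theta_{\rm SIMEX}=\mathcal G(-1,\widehat\Gamma);\qquad \text{(after)}\ \ \widehat\Theta_{\rm SIMEX}=\sum_{j=1}^k a_j\,\mathcal G(-1,\widehat\Gamma_j),$$ where either the $a_j$ are prescribed constants or $a_j=\widehat\alpha_j$ is the weight component of $\widehat\xi$. **Regularity conditions.** (i) Let $f$ be either $g$, as a function of $\xi\in\Xi$, or $\psi$ evaluated at a simulated covariate $X^*_{b,i,s}(\lambda_r)$, as a function of $(\Theta,\xi)\in T\times\Xi$. For every such $f$: $f$ is measurable in the data for each parameter value; it is almost surely continuous on its parameter set and dominated there by an integrable function; the population value is interior; near it $f$ is almost surely continuously differentiable, with $f$ dominated by a square-integrable function and its derivative by an integrable one. (ii) $\Theta^{(s)}_{\lambda_r}$ is the unique root in $T$ of $\Theta\mapsto E\{\psi(Y,Z,X^*_{b,s}(\lambda_r),\Theta)\}$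 at the population $\xi$. (iii) Let $\widetilde\Psi$ stack, over $s$ and $r$, the functions $B^{-1}\sum_b\psi(Y,Z,X^*_{b,s}(\lambda_r),\Theta^{(s)}_{\lambda_r})$, followed by $g$, as a function of $\theta=(\Theta_\Lambda,\xi)$ with $\Theta_\Lambda=(\Theta^{(s)}_{\lambda_r})_{s,r}$. Then $\mathcal A=E\{\partial\widetilde\Psi/\partial\theta^{\mathsf T}\}$ is nonsingular at the population value. (iv) For each $s$ there is an interior point $\Gamma_s$ of $\mathcal S$ with $\mathcal G(\lambda_r,\Gamma_s)=\Theta^{(s)}_{\lambda_r}$ for all $r$, and $\max_r\|\mathcal G(\lambda_r,\Gamma)-\Theta^{(s)}_{\lambda_r}\|$ is bounded away from $0$ on $\{\Gamma\in\mathcal S:\|\Gamma-\Gamma_s\|\ge\varepsilon\}$ for every $\varepsilon>0$. (v) $\mathcal G(\lambda_r,\cdot)$ and $\mathcal G(-1,\cdot)$ are continuously differentiable near $\Gamma_s$, $\mathcal G(-1,\cdot)$ is measurable, and with $s_s(\Gamma)^{\mathsf T}=\partial(\mathcal G(\lambda_r,\Gamma))_r/\partial\Gamma^{\mathsf T}$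 the matrix $\Omega_s=s_s(\Gamma_s)C_s^{-1}s_s(\Gamma_s)^{\mathsf T}$ is nonsingular. **Theorem.** Under these conditions each of the estimators is consistent, $\widehat\Theta_{\rm SIMEX}\to_p\Theta_{\rm SIMEX}$, where $\Theta_{\rm SIMEX}=\mathcal G(-1,\Gamma)$ (before), respectively $\sum_ja_j\mathcal G(-1,\Gamma_j)$, with $a_j=\alpha_j$ (the population value) if the weights are estimated (after). As $n\to\infty$, $$n^{1/2}(\widehat\Theta_{\rm SIMEX}-\Theta_{\rm SIMEX})\to_d N(0,\Sigma_{\rm SIMEX}),\qquad \Sigma_{\rm SIMEX}=D\,\mathcal A^{-1}\,E\{\widetilde\Psi\widetilde\Psi^{\mathsf T}\}\,\mathcal A^{-\mathsf T}D^{\mathsf T},\qquad D=\bigl[\,Q^*\mathcal G_\Gamma\,\Omega^{-1}s\,C^{-1}\;\;\; H\,\bigr].$$ Here $\mathcal G_\Gamma=\partial\mathcal G(-1,\Gamma_s)/\partial\Gamma^{\mathsf T}$, $\Omega$, $s$ and $C$ are block diagonal over the series $s$, all evaluated at the population values; $Q^*=I$ (before) or $Q^*=[a_1I\cdots a_kI]$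 (after); and $H=0$, except that for estimated weights $H=\partial\bigl(\sum_j\alpha_j\mathcal G(-1,\Gamma_j)\bigr)/\partial\xi^{\mathsf T}$, i.e. $H$ has column $\mathcal G(-1,\Gamma_j)$ at the coordinate $\alpha_j$ and zeros elsewhere. Moreover $\Sigma_{\rm SIMEX}$ is positive semidefinite and is consistently estimated by the sandwich estimator that replaces the expectations by averages over the sample (including the simulated noise) and all parameters by their estimates $\widehat\Theta_\Lambda,\widehat\xi,\widehat\Gamma$. -/

import Mathlib

open MeasureTheory ProbabilityTheory Filter Topology Matrix WithLp
open scoped MatrixOrder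

noncomputable section

namespace Simex

/-! ### Observations and correction parameters -/

/-- Real column vectors of length `n`. -/
abbrev Vec (n : ℕ) := EuclideanSpace ℝ (Fin n)

/-- What is observed on one subject: the outcome, the error-free covariates and the `k` proxies. -/
abbrev Obs (𝒴 𝒵 : Type*) (k p : ℕ) := 𝒴 × 𝒵 × (Fin k → Vec p)

/-- The coordinates of the vector `ξ` of correction parameters: the intercepts `η₀ⱼ`, the slopes
`η₁ⱼ`, the distinct entries of the symmetric error covariance matrices `Mⱼ`, the weights `αⱼ`, and
any further parameters (means and covariances of the proxies, moments of the true covariate, ...)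
that are estimated jointly with them. -/
inductive CorrIdx (k p : ℕ) (κ : Type*)
  | eta0 (j : Fin k) (a : Fin p)
  | eta1 (j : Fin k) (a : Fin p)
  | errVar (j : Fin k) (e : Sym2 (Fin p))
  | weight (j : Fin k)
  | aux (c : κ)
  deriving DecidableEq, Fintype

/-- The space of correction parameters `ξ`. -/
abbrev Corr (k p : ℕ) (κ : Type*) := EuclideanSpace ℝ (CorrIdx k p κ)

section Correction

variable {k p : ℕ} {κ : Type*}

/-- `η₀ⱼ`. -/
def eta0 (ξ : Corr k p κ) (j : Fin k) : Vec p := toLp 2 fun a => ξ (.eta0 j a)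

/-- `η₁ⱼ`. -/
def eta1 (ξ : Corr k p κ) (j : Fin k) : Vec p := toLp 2 fun a => ξ (.eta1 j a)

/-- `Mⱼ`. -/
def errVar (ξ : Corr k p κ) (j : Fin k) : Matrix (Fin p) (Fin p) ℝ :=
  of fun a c => ξ (.errVar j s(a, c))

/-- `αⱼ`. -/
def weight (ξ : Corr k p κ) (j : Fin k) : ℝ := ξ (.weight j)

/-- `η₁⁻¹ ∘ (x - η₀ + λ^{1/2} M^{1/2} ν)`, with the entrywise inverse and product and the positive
semidefinite square root. -/
def remeasure (lam : ℝ) (x e0 e1 : Vec p) (M : Matrix (Fin p) (Fin p) ℝ) (nu : Vec p) : Vec p :=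
  toLp 2 fun a => (e1 a)⁻¹ * (x a - e0 a + √lam * (CFC.sqrt M *ᵥ ofLp nu) a)

/-- A way of turning the `k` proxies into one or several (indexed by `S`) simulated error-prone
covariates, given `λ`, the proxies, the simulated noise and `ξ`. -/
abbrev Simulation (S : Type*) (k p : ℕ) (κ : Type*) :=
  S → ℝ → (Fin k → Vec p) → Vec p → Corr k p κ → Vec p

/-- Remeasurement of each proxy separately; the estimates are averaged after extrapolation. -/
def simulateEach : Simulation (Fin k) k p κ := fun j lam x nu ξ =>
  remeasure lam (x j) (eta0 ξ j) (eta1 ξ j) (errVar ξ j) nu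

/-- Remeasurement of the averaged proxy `∑ αⱼ X*ⱼ`, whose intercept, slope and error covariance
are `∑ αⱼ η₀ⱼ`, `∑ αⱼ η₁ⱼ` and `∑ αⱼ² Mⱼ`. -/
def simulateMean : Simulation Unit k p κ := fun _ lam x nu ξ =>
  remeasure lam (∑ j, weight ξ j • x j) (∑ j, weight ξ j • eta0 ξ j)
    (∑ j, weight ξ j • eta1 ξ j) (∑ j, weight ξ j ^ 2 • errVar ξ j) nu

end Correction

/-! ### Ingredients -/

/-- The ingredients that both estimators share. -/
structure Problem (𝒴 𝒵 : Type*) [MeasurableSpace 𝒴] [MeasurableSpace 𝒵] (k p d m R : ℕ)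
    (κ : Type*) where
  /-- the distribution of one observation -/
  P : Measure (Obs 𝒴 𝒵 k p)
  /-- the estimating function for the parameter of interest -/
  psi : 𝒴 → 𝒵 → Vec p → Vec d → Vec d
  /-- the estimating function for the correction parameters -/
  g : Obs 𝒴 𝒵 k p → Corr k p κ → Corr k p κ
  /-- the grid `λ₁, …, λ_R` -/
  grid : Fin R → ℝ
  /-- the extrapolant `𝒢(λ, Γ)` -/
  G : ℝ → Vec m → Vec d
  /-- the parameter space of `Θ` -/
  thetaSet : Set (Vec d)
  /-- the parameter space of `ξ` -/
  xiSet : Set (Corr k p κ)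
  /-- the parameter space of `Γ` -/
  gammaSet : Set (Vec m)
  /-- the population value of `ξ` -/
  xi : Corr k p κ

/-- The ingredients specific to one of the two estimators; `S` indexes the simulated covariates
that are extrapolated separately. -/
structure Arm (S : Type*) (k p d m R : ℕ) (κ : Type*) where
  /-- the simulated covariates -/
  sim : Simulation S k p κ
  /-- the matrices in the least squares criterion -/
  C : S → Matrix (Fin R × Fin d) (Fin R × Fin d) ℝ
  /-- the population values `Θ_{λ_r}` -/
  theta : S → Fin R → Vec d
  /-- the population values of `Γ` -/
  gamma : S → Vec m

/-- The estimators: `ξ̂`, the `Θ̂_{b,λ_r}` and `Γ̂`, for each sample size `n`. -/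
structure Estimators (Ω S : Type*) (k p d m R B : ℕ) (κ : Type*) where
  xi : ℕ → Ω → Corr k p κ
  theta : ℕ → Fin B → S → Fin R → Ω → Vec d
  gamma : ℕ → S → Ω → Vec m

/-- The matrix of partial derivatives. -/
def jacobian {ι τ : Type*} [Fintype τ] [DecidableEq τ] (f : EuclideanSpace ℝ τ → ι → ℝ)
    (x : EuclideanSpace ℝ τ) : Matrix ι τ ℝ :=
  of fun i c => fderiv ℝ (fun y => f y i) x (EuclideanSpace.single c 1)

/-- `p n` holds with probability tending to one. -/
def WithProbTendingToOne {Ω : Type*} [MeasurableSpace Ω] (μ : Measure Ω) (p : ℕ → Ω → Prop) :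
    Prop :=
  Tendsto (fun n => μ {ω | ¬ p n ω}) atTop (𝓝 0)

section Estimation

variable {𝒴 𝒵 : Type*} [MeasurableSpace 𝒴] [MeasurableSpace 𝒵] {k p d m R B : ℕ}
  {κ : Type*} {S : Type*} {Ω : Type*}

/-- One subject together with its simulated noise `ν_{bs}`. -/
abbrev Aug (𝒴 𝒵 : Type*) (k p B : ℕ) (S : Type*) := Obs 𝒴 𝒵 k p × (Fin B → S → Vec p)

/-- `ψ(Y, Z, X*_b(λ_r), Θ)` as a function of `(Θ, ξ)`. -/
def score (pr : Problem 𝒴 𝒵 k p d m R κ) (arm : Arm S k p d m R κ) (s : S) (r : Fin R)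
    (v : Obs 𝒴 𝒵 k p × Vec p) (t : Vec d × Corr k p κ) : Vec d :=
  pr.psi v.1.1 v.1.2.1 (arm.sim s (pr.grid r) v.1.2.2 v.2 t.2) t.1

/-- Coordinates of the stacked parameter `(Θ_Λ, ξ)`. -/
abbrev StackIdx (S : Type*) (k p d R : ℕ) (κ : Type*) := ((Fin R × Fin d) × S) ⊕ CorrIdx k p κ

/-- The stacked parameter `(Θ_Λ, ξ)`. -/
def stack (theta : S → Fin R → Vec d) (xi : Corr k p κ) :
    EuclideanSpace ℝ (StackIdx S k p d R κ) :=
  toLp 2 <| Sum.elim (fun i => theta i.2 i.1.1 i.1.2) (fun c => xi c)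

/-- The stacked estimating function: the averages over `b` of the `ψ_{ib}(λ_r)`, then `g_i`. -/
def stackedScore (pr : Problem 𝒴 𝒵 k p d m R κ) (arm : Arm S k p d m R κ)
    (w : Aug 𝒴 𝒵 k p B S) (t : EuclideanSpace ℝ (StackIdx S k p d R κ)) :
    StackIdx S k p d R κ → ℝ :=
  Sum.elim
    (fun i => (B : ℝ)⁻¹ * ∑ b, score pr arm i.2 i.1.1 (w.1, w.2 b i.2)
      (toLp 2 fun a => t (.inl ((i.1.1, a), i.2)), toLp 2 fun c => t (.inr c)) i.1.2)
    (fun c => pr.g w.1 (toLp 2 fun c' => t (.inr c')) c)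

/-- The distribution of one subject together with its noise: the noise vectors are independent
standard normal and independent of the observation. -/
def augLaw [Fintype S] (pr : Problem 𝒴 𝒵 k p d m R κ) (B : ℕ) : Measure (Aug 𝒴 𝒵 k p B S) :=
  pr.P.prod (Measure.pi fun _ => Measure.pi fun _ => stdGaussian (Vec p))

/-- `𝒢(Λ, Γ)`. -/
def gridFit (pr : Problem 𝒴 𝒵 k p d m R κ) (gam : Vec m) : Fin R × Fin d → ℝ :=
  fun i => pr.G (pr.grid i.1) gam i.2

/-- The least squares criterion `R(Γ)ᵀ C⁻¹ R(Γ)` with `R(Γ) = Θ_Λ - 𝒢(Λ, Γ)`. -/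
def criterion (pr : Problem 𝒴 𝒵 k p d m R κ) (C : Matrix (Fin R × Fin d) (Fin R × Fin d) ℝ)
    (theta : Fin R → Vec d) (gam : Vec m) : ℝ :=
  let res : Fin R × Fin d → ℝ := fun i => theta i.1 i.2 - gridFit pr gam i
  res ⬝ᵥ (C⁻¹ *ᵥ res)

/-- `Θ̂_{λ_r} = B⁻¹ ∑_b Θ̂_{b,λ_r}`. -/
def Estimators.thetaBar (est : Estimators Ω S k p d m R B κ) (n : ℕ) (ω : Ω) (s : S) (r : Fin R) :
    Vec d :=
  (B : ℝ)⁻¹ • ∑ b, est.theta n b s r ω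

/-- The weighted average of the extrapolated values `𝒢(-1, Γₛ)`. -/
def extrapolate [Fintype S] (pr : Problem 𝒴 𝒵 k p d m R κ) (a : S → ℝ) (gam : S → Vec m) : Vec d :=
  ∑ s, a s • pr.G (-1) (gam s)

/-! ### The sampling scheme and the estimators -/

/-- The augmented observations `wᵢ = (Oᵢ, νᵢ)` are independent over `i`, the `Oᵢ` have law `P`, and
the noise is standard normal and independent of them. -/
structure IsSample [MeasurableSpace Ω] [Fintype S] (μ : Measure Ω)
    (pr : Problem 𝒴 𝒵 k p d m R κ) (w : ℕ → Ω → Aug 𝒴 𝒵 k p B S) : Prop where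
  measurable : ∀ i, Measurable (w i)
  indep : iIndepFun w μ
  law : ∀ i, μ.map (w i) = augLaw pr B

/-- The steps of the procedure: with probability tending to one, `ξ̂` solves its equation, each
`Θ̂_{b,λ_r}` solves the equation with simulated data and plugged-in `ξ̂`, and each `Γ̂` is a least
squares fit. -/
structure IsSimexFit [MeasurableSpace Ω] [Fintype κ] (μ : Measure Ω)
    (pr : Problem 𝒴 𝒵 k p d m R κ) (arm : Arm S k p d m R κ) (w : ℕ → Ω → Aug 𝒴 𝒵 k p B S)
    (est : Estimators Ω S k p d m R B κ) : Prop where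
  xi_measurable : ∀ n, Measurable (est.xi n)
  theta_measurable : ∀ n b s r, Measurable (est.theta n b s r)
  gamma_measurable : ∀ n s, Measurable (est.gamma n s)
  xi_solves : WithProbTendingToOne μ fun n ω =>
    est.xi n ω ∈ pr.xiSet ∧
      (n : ℝ)⁻¹ • ∑ i ∈ Finset.range n, pr.g (w i ω).1 (est.xi n ω) = 0
  theta_solves : ∀ b s r, WithProbTendingToOne μ fun n ω =>
    est.theta n b s r ω ∈ pr.thetaSet ∧
      (n : ℝ)⁻¹ • ∑ i ∈ Finset.range n, score pr arm s r ((w i ω).1, (w i ω).2 b s)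
        (est.theta n b s r ω, est.xi n ω) = 0
  gamma_minimizes : ∀ s, WithProbTendingToOne μ fun n ω =>
    est.gamma n s ω ∈ pr.gammaSet ∧
      IsMinOn (criterion pr (arm.C s) (est.thetaBar n ω s)) pr.gammaSet (est.gamma n s ω)

/-! ### Regularity conditions -/

/-- The usual smoothness and domination conditions on an estimating function `f` with values
`f v e` at the observation `v` and the parameter `e`, on a parameter space `K` and near the
population value `e₀`. -/
structure RegularScore {V E F : Type*} [MeasurableSpace V] [NormedAddCommGroup E] [NormedSpace ℝ E]
    [NormedAddCommGroup F] [NormedSpace ℝ F] [MeasurableSpace F] (Q : Measure V) (f : V → E → F)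
    (K : Set E) (e₀ : E) : Prop where
  measurable : ∀ e, Measurable fun v => f v e
  mem_interior : e₀ ∈ interior K
  continuousOn : ∀ᵐ v ∂Q, ContinuousOn (f v) K
  dominated : ∃ F₀ : V → ℝ, Integrable F₀ Q ∧ ∀ᵐ v ∂Q, ∀ e ∈ K, ‖f v e‖ ≤ F₀ v
  unbiased : ∫ v, f v e₀ ∂Q = 0
  smooth_near : ∃ U : Set E, IsOpen U ∧ e₀ ∈ U ∧
    (∀ᵐ v ∂Q, ContDiffOn ℝ 1 (f v) U) ∧
    (∃ F₁ : V → ℝ, MemLp F₁ 2 Q ∧ ∀ᵐ v ∂Q, ∀ e ∈ U, ‖f v e‖ ≤ F₁ v) ∧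
    (∃ F₂ : V → ℝ, Integrable F₂ Q ∧ ∀ᵐ v ∂Q, ∀ e ∈ U, ‖fderiv ℝ (f v) e‖ ≤ F₂ v)

/-- `𝒜(Λ)`, the expected Jacobian of the stacked estimating function. -/
def breadMatrix [Fintype S] [DecidableEq S] [Fintype κ] [DecidableEq κ]
    (pr : Problem 𝒴 𝒵 k p d m R κ) (arm : Arm S k p d m R κ) (B : ℕ) :
    Matrix (StackIdx S k p d R κ) (StackIdx S k p d R κ) ℝ :=
  of fun i c => ∫ w, jacobian (stackedScore pr arm w) (stack arm.theta pr.xi) i c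
    ∂(augLaw pr B : Measure (Aug 𝒴 𝒵 k p B S))

/-- `s(Γ)ᵀ`, the Jacobian of `𝒢(Λ, ·)`. -/
def fitJacobian (pr : Problem 𝒴 𝒵 k p d m R κ) (gam : Vec m) :
    Matrix (Fin R × Fin d) (Fin m) ℝ :=
  jacobian (gridFit pr) gam

/-- `Ω(Γ) = s(Γ) C⁻¹ s(Γ)ᵀ`. -/
def gramMatrix (pr : Problem 𝒴 𝒵 k p d m R κ) (C : Matrix (Fin R × Fin d) (Fin R × Fin d) ℝ)
    (gam : Vec m) : Matrix (Fin m) (Fin m) ℝ :=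
  (fitJacobian pr gam)ᵀ * C⁻¹ * fitJacobian pr gam

/-- Regularity conditions on the ingredients that both estimators share. -/
structure Problem.Regular [Fintype κ] (pr : Problem 𝒴 𝒵 k p d m R κ) : Prop where
  grid_nonneg : ∀ r, 0 ≤ pr.grid r
  grid_strictMono : StrictMono pr.grid
  thetaSet_compact : IsCompact pr.thetaSet
  xiSet_compact : IsCompact pr.xiSet
  g_regular : RegularScore pr.P pr.g pr.xiSet pr.xi
  xi_unique : ∀ x ∈ pr.xiSet, ∫ o, pr.g o x ∂pr.P = 0 → x = pr.xi
  G_measurable : Measurable (pr.G (-1))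

/-- Regularity conditions specific to one of the two estimators. -/
structure Arm.Regular [Fintype S] [DecidableEq S] [Fintype κ] [DecidableEq κ]
    (pr : Problem 𝒴 𝒵 k p d m R κ) (arm : Arm S k p d m R κ) (B : ℕ) : Prop where
  score_regular : ∀ s r, RegularScore (pr.P.prod (stdGaussian (Vec p))) (score pr arm s r)
    (pr.thetaSet ×ˢ pr.xiSet) (arm.theta s r, pr.xi)
  theta_unique : ∀ s r, ∀ t ∈ pr.thetaSet,
    ∫ v, score pr arm s r v (t, pr.xi) ∂(pr.P.prod (stdGaussian (Vec p))) = 0 → t = arm.theta s r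
  bread_nonsingular : IsUnit (breadMatrix pr arm B).det
  C_posDef : ∀ s, (arm.C s).PosDef
  /-- the extrapolant is exact on the grid -/
  fit_exact : ∀ s r, pr.G (pr.grid r) (arm.gamma s) = arm.theta s r
  gamma_interior : ∀ s, arm.gamma s ∈ interior pr.gammaSet
  /-- the extrapolant determines its parameter, in the well-separated sense -/
  gamma_separated : ∀ s, ∀ ε > 0, ∃ δ > 0, ∀ gam ∈ pr.gammaSet, ε ≤ dist gam (arm.gamma s) →
    ∃ r, δ ≤ dist (pr.G (pr.grid r) gam) (arm.theta s r)
  G_smooth : ∀ s r, ContDiffAt ℝ 1 (pr.G (pr.grid r)) (arm.gamma s)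
  G_smooth_neg_one : ∀ s, ContDiffAt ℝ 1 (pr.G (-1)) (arm.gamma s)
  gram_nonsingular : ∀ s, IsUnit (gramMatrix pr (arm.C s) (arm.gamma s)).det

/-! ### Asymptotic covariance matrices and their sandwich estimators -/

section Covariance

variable [Fintype S] [DecidableEq S] [Fintype κ] [DecidableEq κ]

/-- `Σ`, the second moment matrix of the stacked estimating function. -/
def meatMatrix (pr : Problem 𝒴 𝒵 k p d m R κ) (arm : Arm S k p d m R κ) (B : ℕ) :
    Matrix (StackIdx S k p d R κ) (StackIdx S k p d R κ) ℝ :=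
  of fun i c => ∫ w, stackedScore pr arm w (stack arm.theta pr.xi) i *
      stackedScore pr arm w (stack arm.theta pr.xi) c
    ∂(augLaw pr B : Measure (Aug 𝒴 𝒵 k p B S))

/-- The empirical counterpart of `breadMatrix`. -/
def breadHat (pr : Problem 𝒴 𝒵 k p d m R κ) (arm : Arm S k p d m R κ)
    (w : ℕ → Ω → Aug 𝒴 𝒵 k p B S) (est : Estimators Ω S k p d m R B κ) (n : ℕ) (ω : Ω) :
    Matrix (StackIdx S k p d R κ) (StackIdx S k p d R κ) ℝ :=
  (n : ℝ)⁻¹ • ∑ i ∈ Finset.range n,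
    jacobian (stackedScore pr arm (w i ω)) (stack (est.thetaBar n ω) (est.xi n ω))

/-- The empirical counterpart of `meatMatrix`. -/
def meatHat (pr : Problem 𝒴 𝒵 k p d m R κ) (arm : Arm S k p d m R κ)
    (w : ℕ → Ω → Aug 𝒴 𝒵 k p B S) (est : Estimators Ω S k p d m R B κ) (n : ℕ) (ω : Ω) :
    Matrix (StackIdx S k p d R κ) (StackIdx S k p d R κ) ℝ :=
  (n : ℝ)⁻¹ • ∑ i ∈ Finset.range n,
    vecMulVec (stackedScore pr arm (w i ω) (stack (est.thetaBar n ω) (est.xi n ω)))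
      (stackedScore pr arm (w i ω) (stack (est.thetaBar n ω) (est.xi n ω)))

/-- `Q* = [a₁ I ⋯ aₖ I]`. -/
def averagingMatrix (d : ℕ) (a : S → ℝ) : Matrix (Fin d) (Fin d × S) ℝ :=
  of fun i c => if i = c.1 then a c.2 else 0

/-- `Q* 𝒢_Γ(-1, Γ) Ω(Γ)⁻¹ s(Γ) C⁻¹`, with block diagonal matrices over `S`. -/
def extrapolationMatrix (pr : Problem 𝒴 𝒵 k p d m R κ)
    (C : S → Matrix (Fin R × Fin d) (Fin R × Fin d) ℝ) (a : S → ℝ) (gam : S → Vec m) :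
    Matrix (Fin d) ((Fin R × Fin d) × S) ℝ :=
  averagingMatrix d a
    * blockDiagonal (fun s => jacobian (fun y i => pr.G (-1) y i) (gam s))
    * (blockDiagonal fun s => gramMatrix pr (C s) (gam s))⁻¹
    * (blockDiagonal fun s => fitJacobian pr (gam s))ᵀ
    * (blockDiagonal C)⁻¹

/-- The derivative of `∑ⱼ αⱼ 𝒢(-1, Γⱼ)` with respect to `ξ`, through the weights `αⱼ`. -/
def weightMatrix (pr : Problem 𝒴 𝒵 k p d m R κ) (gam : Fin k → Vec m) :
    Matrix (Fin d) (CorrIdx k p κ) ℝ :=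
  of fun i c => match c with
    | .weight j => pr.G (-1) (gam j) i
    | _ => 0

/-- `[D T] A⁻¹ M A⁻ᵀ [D T]ᵀ`. For `T = 0`, `[D T]` is `D Q` with `Q = [I 0]`. -/
def sandwich (D : Matrix (Fin d) ((Fin R × Fin d) × S) ℝ) (T : Matrix (Fin d) (CorrIdx k p κ) ℝ)
    (A M : Matrix (StackIdx S k p d R κ) (StackIdx S k p d R κ) ℝ) : Matrix (Fin d) (Fin d) ℝ :=
  fromCols D T * A⁻¹ * M * (A⁻¹)ᵀ * (fromCols D T)ᵀ

end Covariance

end Estimation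

/-- The estimator `est` is consistent for `target`, `n^{1/2} (est - target)` converges in
distribution to `N(0, V)`, and `Vhat` is a consistent estimator of `V`. -/
structure ConsistentAsymptoticallyNormal {Ω : Type*} [MeasurableSpace Ω] (μ : Measure Ω)
    [IsProbabilityMeasure μ] {d : ℕ} (est : ℕ → Ω → Vec d) (target : Vec d)
    (V : Matrix (Fin d) (Fin d) ℝ) (Vhat : ℕ → Ω → Matrix (Fin d) (Fin d) ℝ) : Prop where
  consistent : TendstoInMeasure μ est atTop fun _ => target
  posSemidef : V.PosSemidef
  normal : TendstoInDistribution (fun (n : ℕ) ω => √(n : ℝ) • (est n ω - target)) atTop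
    (id : Vec d → Vec d) (fun _ => μ) (multivariateGaussian 0 V)
  variance_estimable : ∀ i c, TendstoInMeasure μ (fun n ω => Vhat n ω i c) atTop fun _ => V i c

end Simex

end

noncomputable section

namespace Simex

open Asymptotics

set_option linter.unusedSectionVars false

/-! ### Convergence in probability as convergence along a filter -/

section InProb

variable {Ω : Type*} [MeasurableSpace Ω] {μ : Measure Ω}

/-! The estimators are smooth functions of roots of estimating equations, so the proof is
consistency, linearization, the central limit theorem and Slutsky's argument. Convergence in
probability is convergence along the filter `inProb μ`. Cluster points and the calculus of `o` and
`O` then apply to random sequences as they do to deterministic ones. Probability enters only through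
the law of large numbers, an `L²` bound at rate `√n` and the central limit theorem.

Consistency: along any finer filter on which the roots converge, the law of large numbers at a
converging random parameter (`IsIID.tendsto_sampleMean_apply`) makes the limit a root of the
population equation. That root is unique, so compactness gives convergence along the whole filter.
For `Γ̂`, the criterion at the population value tends to zero. By minimality so does the criterion
at `Γ̂`, and the separation condition finishes (`tendsto_leastSquares`).

Linearization: the average `Θ̂_λ` over replicates need not solve the averaged equation, whereas each
replicate solves its own equation. So each replicate is expanded separately (`isLittleO_replicate`).
The replicates are identically distributed and share the expected Jacobian `𝒜`, so averaging the
expansions gives `(Θ̂_Λ, ξ̂) - θ = -𝒜⁻¹ · mean of Ψ̃ + o` (`isLittleO_stack`). The normal equations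
give `Γ̂ - Γ = Ω⁻¹ s C⁻¹ (Θ̂_Λ - Θ_Λ) + o` (`isLittleO_leastSquares`). The chain rule, together with
the derivative of the weights, produces the matrix `D` (`isLittleO_extrapolate`).

The central limit theorem for the linear image `-D 𝒜⁻¹ Ψ̃` yields the limit law. The sandwich
estimator converges by the same law of large numbers and continuity of the matrix operations. All
versions of the estimator are instances of weights affine in `ξ`, with derivative zero for constant
weights and a coordinate selector for estimated ones. -/

/-- The filter on `ℕ × Ω` of the events whose probability tends to one. -/
def inProb (μ : Measure Ω) : Filter (ℕ × Ω) where
  sets := {A | Tendsto (fun n => μ {ω | (n, ω) ∉ A}) atTop (𝓝 0)}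
  univ_sets := by simp
  sets_of_superset {A B} hA hAB := by
    refine tendsto_of_tendsto_of_tendsto_of_le_of_le tendsto_const_nhds hA (fun _ => zero_le)
      fun n => measure_mono fun ω hω h => hω (hAB h)
  inter_sets {A B} hA hB := by
    have h := Tendsto.add hA hB
    rw [add_zero] at h
    refine tendsto_of_tendsto_of_tendsto_of_le_of_le tendsto_const_nhds h (fun _ => zero_le)
      fun n => (measure_mono ?_).trans (measure_union_le _ _)
    intro ω hω
    by_contra hc
    simp only [Set.mem_union, Set.mem_ofPred_eq, not_or, not_not] at hc
    exact hω hc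

theorem eventually_inProb_iff {q : ℕ × Ω → Prop} :
    (∀ᶠ x in inProb μ, q x) ↔ Tendsto (fun n => μ {ω | ¬ q (n, ω)}) atTop (𝓝 0) :=
  Iff.rfl

theorem WithProbTendingToOne.eventually {q : ℕ → Ω → Prop} (h : WithProbTendingToOne μ q) :
    ∀ᶠ x in inProb μ, q x.1 x.2 := h

theorem eventually_inProb_of_ae {q : Ω → Prop} (h : ∀ᵐ ω ∂μ, q ω) :
    ∀ᶠ x in inProb μ, q x.2 := by
  rw [eventually_inProb_iff]
  have h0 : μ {ω | ¬ q ω} = 0 := h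
  simp [h0]

theorem tendsto_inProb_iff {E : Type*} [PseudoMetricSpace E] {f : ℕ → Ω → E} {c : E} :
    Tendsto (fun x : ℕ × Ω => f x.1 x.2) (inProb μ) (𝓝 c) ↔
      TendstoInMeasure μ f atTop fun _ => c := by
  rw [tendstoInMeasure_iff_dist, Metric.tendsto_nhds]
  simp only [eventually_inProb_iff, not_lt]

/-- Boundedness in probability. -/
def BoundedInProb {E : Type*} [Norm E] (μ : Measure Ω) (Z : ℕ → Ω → E) : Prop :=
  ∀ ε : ENNReal, 0 < ε → ∃ M : ℝ, ∀ n, μ {ω | M < ‖Z n ω‖} ≤ ε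

/-- Slutsky's argument: a remainder that is `o(v)` along `inProb μ` is negligible at every rate at
which `v` stays bounded in probability. -/
theorem BoundedInProb.tendsto_smul {E F : Type*} [NormedAddCommGroup E] [NormedSpace ℝ E]
    [NormedAddCommGroup F] [NormedSpace ℝ F] {r : ℕ → ℝ} {u : ℕ × Ω → F} {v : ℕ × Ω → E}
    (hZ : BoundedInProb μ fun n ω => r n • v (n, ω))
    (huv : u =o[inProb μ] v) :
    Tendsto (fun x => r x.1 • u x) (inProb μ) (𝓝 0) := by
  rw [Metric.tendsto_nhds]
  intro ε hε
  rw [eventually_inProb_iff, ENNReal.tendsto_nhds_zero]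
  intro η hη
  obtain ⟨M, hM⟩ := hZ (η / 2) (ENNReal.half_pos hη.ne')
  -- `M` may be negative, hence `|M| + 1`. Off two events of probability at most `η / 2` each, the
  -- norm is at most `ε / 2 / (|M| + 1)` times `|M| + 1`.
  have hM' : 0 < |M| + 1 := by positivity
  have h1 := huv.bound (show 0 < ε / 2 / (|M| + 1) by positivity)
  rw [eventually_inProb_iff, ENNReal.tendsto_nhds_zero] at h1
  filter_upwards [h1 (η / 2) (ENNReal.half_pos hη.ne')] with n hn
  calc μ {ω | ¬ dist (r n • u (n, ω)) 0 < ε}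
      ≤ μ ({ω | ¬ ‖u (n, ω)‖ ≤ ε / 2 / (|M| + 1) * ‖v (n, ω)‖} ∪ {ω | M < ‖r n • v (n, ω)‖}) := by
        refine measure_mono fun ω hω => ?_
        by_contra hc
        simp only [Set.mem_union, Set.mem_ofPred_eq, not_or, not_not, not_lt] at hc
        refine hω ?_
        have h2 : ‖r n • v (n, ω)‖ ≤ |M| + 1 := hc.2.trans (by
          linarith [le_abs_self M])
        rw [dist_zero_right, norm_smul]
        rw [norm_smul] at h2
        calc ‖r n‖ * ‖u (n, ω)‖ ≤ ‖r n‖ * (ε / 2 / (|M| + 1) * ‖v (n, ω)‖) := by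
              gcongr; exact hc.1
          _ = ε / 2 / (|M| + 1) * (‖r n‖ * ‖v (n, ω)‖) := by ring
          _ ≤ ε / 2 / (|M| + 1) * (|M| + 1) := by gcongr
          _ = ε / 2 := by field_simp
          _ < ε := by linarith
    _ ≤ η / 2 + η / 2 := (measure_union_le _ _).trans (add_le_add hn (hM n))
    _ = η := ENNReal.add_halves η

/-- Markov's inequality for the squared norm, uniformly in `n`. -/
theorem BoundedInProb.of_memLp {E : Type*} [NormedAddCommGroup E] {Z : ℕ → Ω → E} {c : ℝ}
    [IsProbabilityMeasure μ] (hZ : ∀ n, MemLp (Z n) 2 μ) (hc : ∀ n, ∫ ω, ‖Z n ω‖ ^ 2 ∂μ ≤ c) :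
    BoundedInProb μ Z := by
  intro ε hε
  rcases eq_or_ne ε ⊤ with rfl | hε'
  · exact ⟨0, fun n => le_top⟩
  have hε0 : 0 < ε.toReal := ENNReal.toReal_pos hε.ne' hε'
  have hc0 : 0 ≤ c := (integral_nonneg fun ω => by positivity).trans (hc 0)
  -- With `c + 1` in place of `c`, the factor cancelled at the end is positive even when `c = 0`.
  refine ⟨√((c + 1) / ε.toReal), fun n => ?_⟩
  have h1 := mul_meas_ge_le_integral_of_nonneg (μ := μ) (f := fun ω => ‖Z n ω‖ ^ 2)
    (Eventually.of_forall fun ω => by positivity) ((hZ n).integrable_norm_pow (by norm_num))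
    ((c + 1) / ε.toReal)
  have h2 : μ {ω | √((c + 1) / ε.toReal) < ‖Z n ω‖} ≤
      μ {ω | (c + 1) / ε.toReal ≤ ‖Z n ω‖ ^ 2} := measure_mono fun ω hω =>
    (Real.sqrt_le_left (norm_nonneg _)).1 (le_of_lt hω)
  refine h2.trans ?_
  refine (ENNReal.toReal_le_toReal (measure_ne_top μ _) hε').1 ?_
  have h3 : (c + 1) / ε.toReal * μ.real {ω | (c + 1) / ε.toReal ≤ ‖Z n ω‖ ^ 2} ≤ c + 1 :=
    h1.trans ((hc n).trans (by linarith))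
  rw [div_mul_eq_mul_div, div_le_iff₀ hε0] at h3
  have h4 : (0 : ℝ) < c + 1 := by linarith
  exact le_of_mul_le_mul_left h3 h4

end InProb

/-! ### Laws of large numbers -/

section SampleMean

variable {Ω V : Type*} [MeasurableSpace Ω] [MeasurableSpace V] {μ : Measure Ω} {Q : Measure V}
  {w : ℕ → Ω → V}

/-- The `w i` are independent with common law `Q`. -/
structure IsIID (μ : Measure Ω) (Q : Measure V) (w : ℕ → Ω → V) : Prop where
  measurable : ∀ i, Measurable (w i)
  indep : iIndepFun w μ
  law : ∀ i, μ.map (w i) = Q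

/-- The average of `h` over the first `n` observations, as a function of `(n, ω)`. -/
def sampleMean {F : Type*} [AddCommGroup F] [Module ℝ F] (w : ℕ → Ω → V) (h : V → F)
    (x : ℕ × Ω) : F :=
  (x.1 : ℝ)⁻¹ • ∑ i ∈ Finset.range x.1, h (w i x.2)

theorem IsIID.measurePreserving (hw : IsIID μ Q w) (i : ℕ) : MeasurePreserving (w i) μ Q :=
  ⟨hw.measurable i, hw.law i⟩

theorem IsIID.ae_all (hw : IsIID μ Q w) {q : V → Prop} (h : ∀ᵐ v ∂Q, q v) :
    ∀ᵐ ω ∂μ, ∀ i, q (w i ω) :=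
  ae_all_iff.2 fun i => (hw.measurePreserving i).quasiMeasurePreserving.ae h

theorem IsIID.eventually_all (hw : IsIID μ Q w) {q : V → Prop} (h : ∀ᵐ v ∂Q, q v) :
    ∀ᶠ x in inProb μ, ∀ i, q (w i x.2) :=
  eventually_inProb_of_ae (hw.ae_all h)

theorem IsIID.eventually_sampleMean_congr (hw : IsIID μ Q w) {F : Type*} [AddCommGroup F]
    [Module ℝ F] {h h' : V → F} (hh : h =ᵐ[Q] h') :
    sampleMean w h =ᶠ[inProb μ] sampleMean w h' := by
  filter_upwards [hw.eventually_all hh] with x hx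
  simp only [sampleMean, hx]

variable {F : Type*} [NormedAddCommGroup F] [NormedSpace ℝ F]

/-- The law of large numbers. -/
theorem IsIID.tendsto_sampleMean [IsProbabilityMeasure μ] [CompleteSpace F] (hw : IsIID μ Q w)
    {h : V → F} (hh : Integrable h Q) :
    Tendsto (sampleMean w h) (inProb μ) (𝓝 (∫ v, h v ∂Q)) := by
  borelize F
  -- Independence and equality in law pass through measurable maps only, so `h` is replaced by a
  -- strongly measurable version. Almost surely the two agree at all observations, there being
  -- countably many.
  obtain ⟨h', hm, hae⟩ := hh.1
  have hh' : Integrable h' Q := hh.congr hae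
  rw [integral_congr_ae hae]
  refine Tendsto.congr' (hw.eventually_sampleMean_congr hae).symm ?_
  refine (tendsto_inProb_iff
    (f := fun n ω => (n : ℝ)⁻¹ • ∑ i ∈ Finset.range n, h' (w i ω))).2 ?_
  have hInt : ∀ i, Integrable (fun ω => h' (w i ω)) μ := fun i =>
    (hw.measurePreserving i).integrable_comp_of_integrable hh'
  refine tendstoInMeasure_of_tendsto_ae (fun n => ?_) ?_
  · exact ((integrable_finsetSum _ fun i _ => hInt i).smul _).1
  have hlaw : ∫ v, h' v ∂Q = ∫ ω, h' (w 0 ω) ∂μ := by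
    rw [← hw.law 0, integral_map (hw.measurable 0).aemeasurable hm.aestronglyMeasurable]
  rw [hlaw]
  refine strong_law_ae (fun i ω => h' (w i ω)) (hInt 0) (fun i j hij => ?_) fun i => ?_
  · exact (hw.indep.indepFun hij).comp hm.measurable hm.measurable
  · refine IdentDistrib.comp (u := h') ⟨(hw.measurable i).aemeasurable,
      (hw.measurable 0).aemeasurable, by rw [hw.law, hw.law]⟩ hm.measurable

variable {E : Type*} [PseudoMetricSpace E] [SecondCountableTopology E]

/-- Integrable envelopes of the oscillation of `f v` at `e₀`, with expectation tending to zero. -/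
theorem exists_oscillation_envelope {f : V → E → F} {K : Set E} {e₀ : E} (he₀ : e₀ ∈ K)
    (hmeas : ∀ e ∈ K, AEStronglyMeasurable (fun v => f v e) Q)
    (hcont : ∀ᵐ v ∂Q, ContinuousOn (f v) K)
    (hdom : ∃ F₀ : V → ℝ, Integrable F₀ Q ∧ ∀ᵐ v ∂Q, ∀ e ∈ K, ‖f v e‖ ≤ F₀ v)
    {ε : ℝ} (hε : 0 < ε) :
    ∃ δ > 0, ∃ h : V → ℝ, Integrable h Q ∧ ∫ v, h v ∂Q < ε ∧
      ∀ᵐ v ∂Q, ∀ e ∈ K, dist e e₀ < δ → ‖f v e - f v e₀‖ ≤ h v := by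
  obtain ⟨F₀, hF₀, hb⟩ := hdom
  -- The envelope is a supremum of oscillations over shrinking balls. Taking it over a countable
  -- dense subset of `K` makes it measurable; continuity extends the bound to all of `K` at the end.
  obtain ⟨D, hDK, hDc, hKD⟩ :=
    (TopologicalSpace.IsSeparable.of_separableSpace K).exists_countable_dense_subset
  let δ : ℕ → ℝ := fun N => 1 / ((N : ℝ) + 1)
  have hδ : ∀ N, 0 < δ N := fun N => Nat.one_div_pos_of_nat
  let g : ℕ → V → ENNReal := fun N v => ⨆ e ∈ D ∩ Metric.ball e₀ (δ N), ‖f v e - f v e₀‖ₑ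
  have hgm : ∀ N, AEMeasurable (g N) Q := fun N =>
    AEMeasurable.biSup _ (hDc.mono Set.inter_subset_left) fun e he =>
      ((hmeas e (hDK he.1)).sub (hmeas e₀ he₀)).enorm
  have hgb : ∀ᵐ v ∂Q, ∀ N, g N v ≤ ENNReal.ofReal (2 * F₀ v) := by
    filter_upwards [hb] with v hv N
    refine iSup₂_le fun e he => ?_
    rw [← ofReal_norm]
    refine ENNReal.ofReal_le_ofReal ((norm_sub_le _ _).trans ?_)
    linarith [hv e (hDK he.1), hv e₀ he₀]
  have hF₀' : ∀ᵐ v ∂Q, 0 ≤ F₀ v := by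
    filter_upwards [hb] with v hv
    exact (norm_nonneg _).trans (hv e₀ he₀)
  have hbound : ∀ N, ∀ᵐ v ∂Q, ‖(g N v).toReal‖ ≤ 2 * F₀ v := fun N => by
    filter_upwards [hgb, hF₀'] with v hv h0
    rw [Real.norm_of_nonneg ENNReal.toReal_nonneg]
    exact ENNReal.toReal_le_of_le_ofReal (by linarith) (hv N)
  -- Continuity of `f v` at `e₀` makes the envelopes vanish pointwise; dominated convergence with
  -- bound `2 * F₀` then makes their expectations vanish.
  have hlim : ∀ᵐ v ∂Q, Tendsto (fun N => (g N v).toReal) atTop (𝓝 0) := by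
    filter_upwards [hcont] with v hv
    rw [Metric.tendsto_atTop]
    intro η hη
    obtain ⟨ρ, hρ, hρ'⟩ := Metric.continuousOn_iff.1 hv e₀ he₀ (η / 2) (by linarith)
    obtain ⟨N₀, hN₀⟩ := exists_nat_one_div_lt hρ
    refine ⟨N₀, fun N hN => ?_⟩
    rw [Real.dist_eq, sub_zero, abs_of_nonneg ENNReal.toReal_nonneg]
    refine (ENNReal.toReal_le_of_le_ofReal (by linarith) (iSup₂_le fun e he => ?_)).trans_lt
      (half_lt_self hη)
    rw [← ofReal_norm, ← dist_eq_norm]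
    refine ENNReal.ofReal_le_ofReal (hρ' e (hDK he.1) ?_).le
    have h1 : δ N ≤ δ N₀ := Nat.one_div_le_one_div hN
    exact (Metric.mem_ball.1 he.2).trans (h1.trans_lt hN₀)
  have hInt := tendsto_integral_of_dominated_convergence (fun v => 2 * F₀ v)
    (fun N => (hgm N).ennreal_toReal.aestronglyMeasurable) (hF₀.const_mul 2) hbound hlim
  rw [integral_zero] at hInt
  obtain ⟨N, hN⟩ := (hInt.eventually (gt_mem_nhds hε)).exists
  refine ⟨δ N, hδ N, fun v => (g N v).toReal,
    (hF₀.const_mul 2).mono' (hgm N).ennreal_toReal.aestronglyMeasurable (hbound N), hN, ?_⟩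
  filter_upwards [hgb, hcont] with v hv hc e he hed
  -- Because the ball is open, a point of the ball in the closure of `D` is a limit of points of `D`
  -- inside the ball, and the bound passes to the limit.
  have hne : (𝓝[D ∩ Metric.ball e₀ (δ N)] e).NeBot := by
    rw [Set.inter_comm, ← mem_closure_iff_nhdsWithin_neBot]
    exact Metric.isOpen_ball.inter_closure ⟨hed, hKD he⟩
  have htend : Tendsto (fun e' => ‖f v e' - f v e₀‖) (𝓝[D ∩ Metric.ball e₀ (δ N)] e)
      (𝓝 ‖f v e - f v e₀‖) :=
    (((hc e he).mono (Set.inter_subset_left.trans hDK)).sub continuousWithinAt_const).norm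
  refine le_of_tendsto htend (eventually_mem_nhdsWithin.mono fun e' he' => ?_)
  have h1 : ‖f v e' - f v e₀‖ₑ ≤ g N v :=
    le_iSup₂ (f := fun e (_ : e ∈ D ∩ Metric.ball e₀ (δ N)) => ‖f v e - f v e₀‖ₑ) e' he'
  have h2 := ENNReal.toReal_mono (ne_top_of_le_ne_top ENNReal.ofReal_ne_top (hv N)) h1
  rwa [toReal_enorm] at h2

theorem norm_sampleMean_sub_le {f g : V → F} {h : V → ℝ} {x : ℕ × Ω}
    (hx : ∀ i, ‖f (w i x.2) - g (w i x.2)‖ ≤ h (w i x.2)) :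
    ‖sampleMean w f x - sampleMean w g x‖ ≤ sampleMean w h x := by
  simp only [sampleMean]
  rw [← smul_sub, ← Finset.sum_sub_distrib, norm_smul, norm_inv, Real.norm_natCast, smul_eq_mul]
  exact mul_le_mul_of_nonneg_left (norm_sum_le_of_le _ fun i _ => hx i) (by positivity)

/-- A law of large numbers at a converging random parameter. -/
theorem IsIID.tendsto_sampleMean_apply [IsProbabilityMeasure μ] [CompleteSpace F]
    (hw : IsIID μ Q w) {f : V → E → F} {K : Set E} {e₀ : E} (he₀ : e₀ ∈ K)
    (hmeas : ∀ e ∈ K, AEStronglyMeasurable (fun v => f v e) Q)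
    (hcont : ∀ᵐ v ∂Q, ContinuousOn (f v) K)
    (hdom : ∃ F₀ : V → ℝ, Integrable F₀ Q ∧ ∀ᵐ v ∂Q, ∀ e ∈ K, ‖f v e‖ ≤ F₀ v)
    {l : Filter (ℕ × Ω)} (hl : l ≤ inProb μ) {θ : ℕ × Ω → E} (hθ : Tendsto θ l (𝓝[K] e₀)) :
    Tendsto (fun x => sampleMean w (fun v => f v (θ x)) x) l (𝓝 (∫ v, f v e₀ ∂Q)) := by
  have hInt : Integrable (fun v => f v e₀) Q := by
    obtain ⟨F₀, hF₀, hb⟩ := hdom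
    exact hF₀.mono' (hmeas e₀ he₀) (hb.mono fun v hv => hv e₀ he₀)
  have h1 := (hw.tendsto_sampleMean hInt).mono_left hl
  -- The summands at a random parameter are not independent. The difference is therefore bounded by
  -- the sample mean of one fixed envelope, to which the ordinary law of large numbers applies.
  suffices h2 : Tendsto (fun x => sampleMean w (fun v => f v (θ x)) x -
      sampleMean w (fun v => f v e₀) x) l (𝓝 0) by
    simpa using h2.add h1
  rw [Metric.tendsto_nhds]
  intro ε hε
  obtain ⟨δ, hδ, h, hh, hhε, hosc⟩ := exists_oscillation_envelope he₀ hmeas hcont hdom hε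
  have h3 := ((hw.tendsto_sampleMean hh).mono_left hl).eventually (gt_mem_nhds hhε)
  have h4 : ∀ᶠ x in l, θ x ∈ K ∧ dist (θ x) e₀ < δ := hθ.eventually
    ((eventually_mem_nhdsWithin).and (mem_nhdsWithin_of_mem_nhds (Metric.ball_mem_nhds e₀ hδ)))
  filter_upwards [h3, h4, hl (hw.eventually_all hosc)] with x hx3 hx4 hx5
  rw [dist_zero_right]
  exact (norm_sampleMean_sub_le fun i => hx5 i _ hx4.1 hx4.2).trans_lt hx3

end SampleMean

/-! ### Locally regular scores and their linearization -/

section LocallyRegular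

variable {V V' E E' F : Type*} [MeasurableSpace V] [MeasurableSpace V']
  [NormedAddCommGroup E] [NormedSpace ℝ E] [NormedAddCommGroup E'] [NormedSpace ℝ E']
  [NormedAddCommGroup F] [NormedSpace ℝ F]
  {Q : Measure V} {Q' : Measure V'} {φ ψ : V → E → ℝ} {e₀ : E}

/-- The local part of the regularity conditions, for a real-valued score. -/
structure LocallyRegular (Q : Measure V) (φ : V → E → ℝ) (e₀ : E) : Prop where
  measurable : ∀ e, Measurable fun v => φ v e
  smooth_near : ∃ U : Set E, IsOpen U ∧ e₀ ∈ U ∧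
    (∀ᵐ v ∂Q, ContDiffOn ℝ 1 (φ v) U) ∧
    (∃ F₁ : V → ℝ, MemLp F₁ 2 Q ∧ ∀ᵐ v ∂Q, ∀ e ∈ U, ‖φ v e‖ ≤ F₁ v) ∧
    (∃ F₂ : V → ℝ, Integrable F₂ Q ∧ ∀ᵐ v ∂Q, ∀ e ∈ U, ‖fderiv ℝ (φ v) e‖ ≤ F₂ v)

/-- Passes to one coordinate `L` of a score, viewed as a function of a larger parameter through the
linear map `A`. This places the separate scores on the common space of stacked parameters. -/
theorem RegularScore.locallyRegular [MeasurableSpace F] [BorelSpace F] {f : V → E → F}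
    {K : Set E} (hf : RegularScore Q f K e₀) (L : F →L[ℝ] ℝ) (A : E' →L[ℝ] E) {e₁ : E'}
    (he : A e₁ = e₀) : LocallyRegular Q (fun v e => L (f v (A e))) e₁ where
  measurable e := L.measurable.comp (hf.measurable (A e))
  smooth_near := by
    obtain ⟨U, hU, heU, hsm, ⟨F₁, hF₁, hb₁⟩, F₂, hF₂, hb₂⟩ := hf.smooth_near
    refine ⟨A ⁻¹' U, hU.preimage A.continuous, by simpa [he] using heU, ?_,
      ⟨fun v => ‖L‖ * F₁ v, hF₁.const_mul _, ?_⟩, fun v => ‖L‖ * F₂ v * ‖A‖,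
      (hF₂.const_mul _).mul_const _, ?_⟩
    · filter_upwards [hsm] with v hv
      exact L.contDiff.comp_contDiffOn (hv.comp A.contDiff.contDiffOn fun _ h => h)
    · filter_upwards [hb₁] with v hv e he
      exact (L.le_opNorm _).trans (mul_le_mul_of_nonneg_left (hv _ he) (norm_nonneg _))
    · filter_upwards [hb₂, hsm] with v hv hs e he
      have hd : DifferentiableAt ℝ (f v) (A e) :=
        (hs.differentiableOn (by simp)).differentiableAt (hU.mem_nhds he)
      have h1 : HasFDerivAt (fun e => L (f v (A e))) (L ∘L (fderiv ℝ (f v) (A e)) ∘L A) e :=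
        L.hasFDerivAt.comp e (hd.hasFDerivAt.comp e A.hasFDerivAt)
      rw [h1.fderiv]
      refine (L.opNorm_comp_le _).trans ?_
      rw [mul_assoc]
      refine mul_le_mul_of_nonneg_left (((fderiv ℝ (f v) (A e)).opNorm_comp_le A).trans ?_)
        (norm_nonneg _)
      exact mul_le_mul_of_nonneg_right (hv _ he) (norm_nonneg _)

theorem LocallyRegular.comp_measurePreserving (hφ : LocallyRegular Q φ e₀) {τ : V' → V}
    (hτ : MeasurePreserving τ Q' Q) : LocallyRegular Q' (fun v => φ (τ v)) e₀ where
  measurable e := (hφ.measurable e).comp hτ.measurable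
  smooth_near := by
    obtain ⟨U, hU, heU, hsm, ⟨F₁, hF₁, hb₁⟩, F₂, hF₂, hb₂⟩ := hφ.smooth_near
    exact ⟨U, hU, heU, hτ.quasiMeasurePreserving.ae hsm,
      ⟨F₁ ∘ τ, hF₁.comp_measurePreserving hτ, hτ.quasiMeasurePreserving.ae hb₁⟩, F₂ ∘ τ,
      hτ.integrable_comp_of_integrable hF₂, hτ.quasiMeasurePreserving.ae hb₂⟩

theorem fderiv_const_mul_sum {ι : Type*} [Fintype ι] {f : ι → E → ℝ} {e : E} (c : ℝ)
    (hf : ∀ b, DifferentiableAt ℝ (f b) e) :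
    fderiv ℝ (fun e => c * ∑ b, f b e) e = c • ∑ b, fderiv ℝ (f b) e := by
  have h : HasFDerivAt (fun e => c * ∑ b, f b e) (c • ∑ b, fderiv ℝ (f b) e) e :=
    (HasFDerivAt.fun_sum fun b _ => (hf b).hasFDerivAt).const_mul c
  exact h.fderiv

theorem LocallyRegular.const_mul_sum {ι : Type*} [Fintype ι] {φ : ι → V → E → ℝ}
    (hφ : ∀ b, LocallyRegular Q (φ b) e₀) (c : ℝ) :
    LocallyRegular Q (fun v e => c * ∑ b, φ b v e) e₀ where
  measurable e := (Finset.measurable_fun_sum _ fun b _ => (hφ b).measurable e).const_mul c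
  smooth_near := by
    choose U hU heU hsm h₁ h₂ using fun b => (hφ b).smooth_near
    choose F₁ hF₁ hb₁ using h₁
    choose F₂ hF₂ hb₂ using h₂
    refine ⟨⋂ b, U b, isOpen_iInter_of_finite hU, Set.mem_iInter.2 heU, ?_,
      ⟨fun v => |c| * ∑ b, F₁ b v, (memLp_finsetSum _ fun b _ => hF₁ b).const_mul _, ?_⟩,
      fun v => |c| * ∑ b, F₂ b v, (integrable_finsetSum _ fun b _ => hF₂ b).const_mul _, ?_⟩
    · filter_upwards [ae_all_iff.2 hsm] with v hv
      exact contDiffOn_const.mul (ContDiffOn.sum fun b _ => (hv b).mono (Set.iInter_subset U b))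
    · filter_upwards [ae_all_iff.2 hb₁] with v hv e he
      rw [norm_mul, Real.norm_eq_abs]
      exact mul_le_mul_of_nonneg_left
        (norm_sum_le_of_le _ fun b _ => hv b e (Set.mem_iInter.1 he b)) (abs_nonneg _)
    · filter_upwards [ae_all_iff.2 hb₂, ae_all_iff.2 hsm] with v hv hs e he
      rw [fderiv_const_mul_sum c fun b => ((hs b).differentiableOn (by simp)).differentiableAt
        ((hU b).mem_nhds (Set.mem_iInter.1 he b)), norm_smul, Real.norm_eq_abs]
      exact mul_le_mul_of_nonneg_left
        (norm_sum_le_of_le _ fun b _ => hv b e (Set.mem_iInter.1 he b)) (abs_nonneg _)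

theorem LocallyRegular.ae_differentiableAt (hφ : LocallyRegular Q φ e₀) :
    ∀ᵐ v ∂Q, DifferentiableAt ℝ (φ v) e₀ := by
  obtain ⟨U, hU, heU, hsm, -⟩ := hφ.smooth_near
  exact hsm.mono fun v hv => (hv.differentiableOn (by simp)).differentiableAt (hU.mem_nhds heU)

theorem LocallyRegular.memLp (hφ : LocallyRegular Q φ e₀) : MemLp (fun v => φ v e₀) 2 Q := by
  obtain ⟨U, hU, heU, -, ⟨F₁, hF₁, hb₁⟩, -⟩ := hφ.smooth_near
  exact hF₁.of_le (hφ.measurable e₀).aestronglyMeasurable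
    (hb₁.mono fun v hv => (hv e₀ heU).trans (le_abs_self _))

variable [FiniteDimensional ℝ E]

/-- Each directional derivative is an almost everywhere limit of measurable difference quotients,
and in finite dimension finitely many of them determine the derivative. -/
theorem aestronglyMeasurable_fderiv (hφ : ∀ e, Measurable fun v => φ v e) {e : E}
    (hd : ∀ᵐ v ∂Q, DifferentiableAt ℝ (φ v) e) :
    AEStronglyMeasurable (fun v => fderiv ℝ (φ v) e) Q := by
  have hdir : ∀ u : E, AEStronglyMeasurable (fun v => fderiv ℝ (φ v) e u) Q := fun u => by
    refine aestronglyMeasurable_of_tendsto_ae (u := atTop)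
      (f := fun (n : ℕ) v => (n : ℝ) • (φ v (e + (n : ℝ)⁻¹ • u) - φ v e)) (fun n => ?_) ?_
    · exact (((hφ _).sub (hφ _)).const_smul (n : ℝ)).aestronglyMeasurable
    · filter_upwards [hd] with v hv
      have h1 := hv.hasFDerivAt.lim_real u
      exact h1.comp tendsto_natCast_atTop_atTop
  let b := Module.finBasis ℝ E
  let co : Fin (Module.finrank ℝ E) → (E →L[ℝ] ℝ) := fun i =>
    LinearMap.toContinuousLinearMap (b.coord i)
  have heq : ∀ T : E →L[ℝ] ℝ, T = ∑ i, T (b i) • co i := fun T => by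
    ext x
    conv_lhs => rw [← b.sum_repr x, map_sum]
    simp only [map_smul, smul_eq_mul, _root_.sum_apply, _root_.smul_apply, co,
      LinearMap.coe_toContinuousLinearMap', Module.Basis.coord_apply]
    exact Finset.sum_congr rfl fun i _ => mul_comm _ _
  have h2 : (fun v => fderiv ℝ (φ v) e) = fun v => ∑ i, fderiv ℝ (φ v) e (b i) • co i :=
    funext fun v => heq _
  rw [h2]
  exact Finset.aestronglyMeasurable_fun_sum _ fun i _ => (hdir (b i)).smul_const (co i)

theorem LocallyRegular.integrable_fderiv (hφ : LocallyRegular Q φ e₀) :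
    Integrable (fun v => fderiv ℝ (φ v) e₀) Q := by
  obtain ⟨U, hU, heU, -, -, F₂, hF₂, hb₂⟩ := hφ.smooth_near
  exact hF₂.mono' (aestronglyMeasurable_fderiv hφ.measurable hφ.ae_differentiableAt)
    (hb₂.mono fun v hv => hv e₀ heU)

theorem LocallyRegular.integral_fderiv_comp (hφ : LocallyRegular Q φ e₀) {τ : V' → V}
    (hτ : MeasurePreserving τ Q' Q) :
    ∫ v, fderiv ℝ (φ (τ v)) e₀ ∂Q' = ∫ v, fderiv ℝ (φ v) e₀ ∂Q := by
  have h := hφ.integrable_fderiv.1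
  rw [← hτ.map_eq] at h ⊢
  exact (integral_map hτ.measurable.aemeasurable h).symm

theorem integral_fderiv_const_mul_sum {ι : Type*} [Fintype ι] {φ : ι → V → E → ℝ}
    (hφ : ∀ b, LocallyRegular Q (φ b) e₀) (c : ℝ) :
    ∫ v, fderiv ℝ (fun e => c * ∑ b, φ b v e) e₀ ∂Q =
      c • ∑ b, ∫ v, fderiv ℝ (φ b v) e₀ ∂Q := by
  rw [← integral_finsetSum _ fun b _ => (hφ b).integrable_fderiv, ← integral_smul]
  refine integral_congr_ae ?_
  filter_upwards [ae_all_iff.2 fun b => (hφ b).ae_differentiableAt] with v hv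
  exact fderiv_const_mul_sum c hv

variable {Ω : Type*} [MeasurableSpace Ω] {μ : Measure Ω} [IsProbabilityMeasure μ]
  {w : ℕ → Ω → V} {θ : ℕ × Ω → E}

theorem LocallyRegular.tendsto_sampleMean_fderiv (hφ : LocallyRegular Q φ e₀) (hw : IsIID μ Q w)
    (hθ : Tendsto θ (inProb μ) (𝓝 e₀)) :
    Tendsto (fun x => sampleMean w (fun v => fderiv ℝ (φ v) (θ x)) x) (inProb μ)
      (𝓝 (∫ v, fderiv ℝ (φ v) e₀ ∂Q)) := by
  obtain ⟨U, hU, heU, hsm, -, hb₂⟩ := hφ.smooth_near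
  refine hw.tendsto_sampleMean_apply (f := fun v e => fderiv ℝ (φ v) e) heU (fun e he => ?_) ?_
    hb₂ le_rfl ?_
  · exact aestronglyMeasurable_fderiv hφ.measurable (hsm.mono fun v hv =>
      (hv.differentiableOn (by simp)).differentiableAt (hU.mem_nhds he))
  · exact hsm.mono fun v hv => hv.continuousOn_fderiv_of_isOpen hU (by simp)
  · rwa [hU.nhdsWithin_eq heU]

/-- The product of two square-integrable envelopes is integrable, so the law of large numbers at a
random parameter applies to products of scores. -/
theorem LocallyRegular.tendsto_sampleMean_mul (hφ : LocallyRegular Q φ e₀)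
    (hψ : LocallyRegular Q ψ e₀) (hw : IsIID μ Q w) (hθ : Tendsto θ (inProb μ) (𝓝 e₀)) :
    Tendsto (fun x => sampleMean w (fun v => φ v (θ x) * ψ v (θ x)) x) (inProb μ)
      (𝓝 (∫ v, φ v e₀ * ψ v e₀ ∂Q)) := by
  obtain ⟨U, hU, heU, hsm, ⟨F₁, hF₁, hb₁⟩, -⟩ := hφ.smooth_near
  obtain ⟨U', hU', heU', hsm', ⟨F₁', hF₁', hb₁'⟩, -⟩ := hψ.smooth_near
  refine hw.tendsto_sampleMean_apply (f := fun v e => φ v e * ψ v e) (K := U ∩ U') ⟨heU, heU'⟩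
    (fun e he => ?_) ?_ ⟨fun v => F₁ v * F₁' v, hF₁.integrable_mul hF₁', ?_⟩ le_rfl ?_
  · exact ((hφ.measurable e).mul (hψ.measurable e)).aestronglyMeasurable
  · filter_upwards [hsm, hsm'] with v hv hv'
    exact (hv.continuousOn.mono Set.inter_subset_left).mul
      (hv'.continuousOn.mono Set.inter_subset_right)
  · filter_upwards [hb₁, hb₁'] with v hv hv' e he
    rw [norm_mul]
    exact mul_le_mul (hv e he.1) (hv' e he.2) (norm_nonneg _)
      ((norm_nonneg _).trans (hv e he.1))
  · rwa [(hU.inter hU').nhdsWithin_eq ⟨heU, heU'⟩]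

/-- The sample mean of a locally regular score is differentiable in probability at the population
value. -/
theorem LocallyRegular.isLittleO_sampleMean_sub (hφ : LocallyRegular Q φ e₀) (hw : IsIID μ Q w)
    (hθ : Tendsto θ (inProb μ) (𝓝 e₀)) :
    (fun x => sampleMean w (fun v => φ v (θ x)) x - sampleMean w (fun v => φ v e₀) x -
      (∫ v, fderiv ℝ (φ v) e₀ ∂Q) (θ x - e₀)) =o[inProb μ] fun x => θ x - e₀ := by
  obtain ⟨U, hU, heU, hsm, -, F₂, hF₂, hb₂⟩ := hφ.smooth_near
  obtain ⟨δ, hδ, hball⟩ := Metric.isOpen_iff.1 hU e₀ heU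
  have hderiv := hw.tendsto_sampleMean hφ.integrable_fderiv
  -- The Taylor remainder divided by the distance to `e₀`. Since `0⁻¹ = 0` it vanishes at `e₀`, and
  -- its continuity there is exactly differentiability of `φ v`. The law of large numbers at the
  -- random parameter therefore sends its sample mean to zero, without any intermediate point.
  let q : V → E → ℝ := fun v e =>
    ‖e - e₀‖⁻¹ * (φ v e - φ v e₀ - fderiv ℝ (φ v) e₀ (e - e₀))
  have hq : Tendsto (fun x => sampleMean w (fun v => q v (θ x)) x) (inProb μ) (𝓝 0) := by
    have h0 : ∫ v, q v e₀ ∂Q = 0 := by simp [q]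
    rw [← h0]
    -- A ball replaces `U` because the mean value inequality, which gives the bound `2 * F₂`, needs
    -- convexity.
    refine hw.tendsto_sampleMean_apply (f := q) (K := Metric.ball e₀ δ)
      (Metric.mem_ball_self hδ) (fun e _ => ?_) ?_ ⟨fun v => 2 * F₂ v, hF₂.const_mul 2, ?_⟩
      le_rfl ?_
    · have hm := (hφ.integrable_fderiv.1).apply_continuousLinearMap (e - e₀)
      exact (((hφ.measurable e).sub (hφ.measurable e₀)).aestronglyMeasurable.sub hm).const_mul _
    · filter_upwards [hsm] with v hv e he
      rcases eq_or_ne e e₀ with rfl | hne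
      · have hd := ((hv.differentiableOn (by simp)).differentiableAt
          (hU.mem_nhds heU)).hasFDerivAt
        have h1 := hasFDerivAt_iff_tendsto.1 hd
        have h2 : ContinuousAt (q v) e := by
          rw [ContinuousAt, show q v e = 0 by simp [q], tendsto_zero_iff_norm_tendsto_zero]
          refine h1.congr fun e' => ?_
          simp [q, norm_mul]
        exact h2.continuousWithinAt
      · have hc : ContinuousAt (φ v) e :=
          hv.continuousOn.continuousAt (hU.mem_nhds (hball he))
        have hn : ‖e - e₀‖ ≠ 0 := norm_ne_zero_iff.2 (sub_ne_zero.2 hne)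
        have h2 : ContinuousAt (q v) e := by
          refine ContinuousAt.mul (ContinuousAt.inv₀ (by fun_prop) hn) ?_
          exact (hc.sub continuousAt_const).sub (by fun_prop)
        exact h2.continuousWithinAt
    · filter_upwards [hsm, hb₂] with v hv hb e he
      have hmv : ‖φ v e - φ v e₀‖ ≤ F₂ v * ‖e - e₀‖ :=
        (convex_ball e₀ δ).norm_image_sub_le_of_norm_fderiv_le
          (fun e' he' => (hv.differentiableOn (by simp)).differentiableAt
            (hU.mem_nhds (hball he'))) (fun e' he' => hb e' (hball he'))
          (Metric.mem_ball_self hδ) he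
      have hl : ‖fderiv ℝ (φ v) e₀ (e - e₀)‖ ≤ F₂ v * ‖e - e₀‖ :=
        (ContinuousLinearMap.le_opNorm _ _).trans
          (mul_le_mul_of_nonneg_right (hb e₀ heU) (norm_nonneg _))
      have hF0 : 0 ≤ F₂ v := (norm_nonneg _).trans (hb e₀ heU)
      rw [norm_mul, norm_inv, norm_norm]
      rcases eq_or_ne e e₀ with rfl | hne
      · simpa using hF0
      have hn : 0 < ‖e - e₀‖ := norm_pos_iff.2 (sub_ne_zero.2 hne)
      rw [inv_mul_le_iff₀ hn]
      calc _ ≤ _ := norm_sub_le _ _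
        _ ≤ F₂ v * ‖e - e₀‖ + F₂ v * ‖e - e₀‖ := add_le_add hmv hl
        _ = ‖e - e₀‖ * (2 * F₂ v) := by ring
    · rwa [Metric.isOpen_ball.nhdsWithin_eq (Metric.mem_ball_self hδ)]
  -- The error splits into the averaged Taylor remainder and the fluctuation of the mean derivative
  -- at `e₀`; each is `o(1)` times the parameter error.
  have hsplit : ∀ x, sampleMean w (fun v => φ v (θ x)) x - sampleMean w (fun v => φ v e₀) x -
      (∫ v, fderiv ℝ (φ v) e₀ ∂Q) (θ x - e₀) =
      ‖θ x - e₀‖ * sampleMean w (fun v => q v (θ x)) x +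
      (sampleMean w (fun v => fderiv ℝ (φ v) e₀) x - ∫ v, fderiv ℝ (φ v) e₀ ∂Q) (θ x - e₀) := by
    intro x
    have h1 : ‖θ x - e₀‖ * sampleMean w (fun v => q v (θ x)) x =
        sampleMean w (fun v => φ v (θ x)) x - sampleMean w (fun v => φ v e₀) x -
          sampleMean w (fun v => fderiv ℝ (φ v) e₀ (θ x - e₀)) x := by
      simp only [sampleMean, q, smul_eq_mul]
      rw [← mul_sub, ← mul_sub, ← Finset.sum_sub_distrib, ← Finset.sum_sub_distrib,
        mul_left_comm, Finset.mul_sum]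
      congr 1
      refine Finset.sum_congr rfl fun i _ => ?_
      rcases eq_or_ne (θ x) e₀ with h | h
      · simp [h]
      · rw [mul_inv_cancel_left₀ (norm_ne_zero_iff.2 (sub_ne_zero.2 h))]
    have h2 : sampleMean w (fun v => fderiv ℝ (φ v) e₀ (θ x - e₀)) x =
        sampleMean w (fun v => fderiv ℝ (φ v) e₀) x (θ x - e₀) := by
      simp [sampleMean]
    rw [h1, h2, _root_.sub_apply]
    ring
  simp only [hsplit]
  refine IsLittleO.add ?_ ?_
  · have := (isBigO_refl (fun x => ‖θ x - e₀‖) (inProb μ)).mul_isLittleO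
      ((isLittleO_one_iff ℝ).2 hq)
    simpa using this
  · have h1 : Tendsto (fun x => sampleMean w (fun v => fderiv ℝ (φ v) e₀) x -
        ∫ v, fderiv ℝ (φ v) e₀ ∂Q) (inProb μ) (𝓝 0) := by
      simpa using hderiv.sub_const (∫ v, fderiv ℝ (φ v) e₀ ∂Q)
    have h2 : (fun x => (sampleMean w (fun v => fderiv ℝ (φ v) e₀) x -
        ∫ v, fderiv ℝ (φ v) e₀ ∂Q) (θ x - e₀)) =O[inProb μ] fun x =>
        ‖sampleMean w (fun v => fderiv ℝ (φ v) e₀) x - ∫ v, fderiv ℝ (φ v) e₀ ∂Q‖ *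
          ‖θ x - e₀‖ :=
      IsBigO.of_bound 1 (Eventually.of_forall fun x => by
        rw [norm_mul, norm_norm, norm_norm, one_mul]
        exact ContinuousLinearMap.le_opNorm _ _)
    refine h2.trans_isLittleO ?_
    have h3 := ((isLittleO_one_iff ℝ).2 (tendsto_zero_iff_norm_tendsto_zero.1 h1)).mul_isBigO
      (isBigO_refl (fun x => ‖θ x - e₀‖) (inProb μ))
    simpa using h3

end LocallyRegular

/-! ### The multivariate central limit theorem -/

section CentralLimit

variable {Ω V ι : Type*} [MeasurableSpace Ω] [MeasurableSpace V] {μ : Measure Ω}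
  [IsProbabilityMeasure μ] {Q : Measure V} {w : ℕ → Ω → V} [Fintype ι]

/-- Expanding the square and integrating term by term. This yields positive semidefiniteness and
identifies the variances of one-dimensional projections. -/
theorem dotProduct_secondMoment_mulVec {h : V → ι → ℝ} (hL : ∀ i, MemLp (fun v => h v i) 2 Q)
    (x : ι → ℝ) :
    x ⬝ᵥ (of fun i c => ∫ v, h v i * h v c ∂Q : Matrix ι ι ℝ) *ᵥ x = ∫ v, (x ⬝ᵥ h v) ^ 2 ∂Q := by
  have hInt : ∀ i c, Integrable (fun v => x i * (h v i * h v c * x c)) Q := fun i c =>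
    (((hL i).integrable_mul (hL c)).mul_const _).const_mul _
  have h1 : ∀ v, (x ⬝ᵥ h v) ^ 2 = ∑ i, ∑ c, x i * (h v i * h v c * x c) := fun v => by
    rw [sq, dotProduct, Finset.sum_mul_sum]
    exact Finset.sum_congr rfl fun i _ => Finset.sum_congr rfl fun c _ => by ring
  simp only [h1]
  rw [integral_finsetSum _ fun i _ => integrable_finsetSum _ fun c _ => hInt i c]
  simp only [dotProduct, mulVec, of_apply, Finset.mul_sum]
  refine Finset.sum_congr rfl fun i _ => ?_
  rw [integral_finsetSum _ fun c _ => hInt i c]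
  refine Finset.sum_congr rfl fun c _ => ?_
  rw [integral_const_mul, integral_mul_const]

theorem posSemidef_secondMoment {h : V → ι → ℝ} (hL : ∀ i, MemLp (fun v => h v i) 2 Q) :
    (of fun i c => ∫ v, h v i * h v c ∂Q : Matrix ι ι ℝ).PosSemidef := by
  refine PosSemidef.of_dotProduct_mulVec_nonneg ?_ fun x => ?_
  · ext i c
    simp [mul_comm]
  · rw [star_trivial, dotProduct_secondMoment_mulVec hL]
    exact integral_nonneg fun v => sq_nonneg _

theorem sqrt_mul_inv_self (n : ℕ) : √(n : ℝ) * (n : ℝ)⁻¹ = (√(n : ℝ))⁻¹ := by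
  rw [← div_eq_mul_inv, Real.sqrt_div_self', one_div]

theorem sqrt_smul_sampleMean {F : Type*} [AddCommGroup F] [Module ℝ F] (h : V → F) (n : ℕ)
    (ω : Ω) : √(n : ℝ) • sampleMean w h (n, ω) =
      (√(n : ℝ))⁻¹ • ∑ i ∈ Finset.range n, h (w i ω) := by
  rw [sampleMean, smul_smul, sqrt_mul_inv_self]

theorem IsIID.integral_eq {F : Type*} [NormedAddCommGroup F] [NormedSpace ℝ F]
    (hw : IsIID μ Q w) {h : V → F} (hm : AEStronglyMeasurable h Q) (i : ℕ) :
    ∫ ω, h (w i ω) ∂μ = ∫ v, h v ∂Q := by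
  rw [← hw.law i] at hm ⊢
  exact (integral_map (hw.measurable i).aemeasurable hm).symm

theorem IsIID.measurable_sqrt_smul_sampleMean (hw : IsIID μ Q w) {h : V → EuclideanSpace ℝ ι}
    (hm : Measurable h) (n : ℕ) : Measurable fun ω => √(n : ℝ) • sampleMean w h (n, ω) := by
  simp only [sqrt_smul_sampleMean]
  exact Measurable.const_smul (Finset.measurable_fun_sum (Finset.range n)
    (f := fun i ω => h (w i ω)) fun i _ => hm.comp (hw.measurable i)) ((√(n : ℝ))⁻¹)

/-- The multivariate central limit theorem. -/
theorem IsIID.tendstoInDistribution_sampleMean [DecidableEq ι] (hw : IsIID μ Q w)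
    {h : V → EuclideanSpace ℝ ι} (hm : Measurable h) (hL : MemLp h 2 Q)
    (h0 : ∀ t : ι → ℝ, ∫ v, t ⬝ᵥ ofLp (h v) ∂Q = 0) {S : Matrix ι ι ℝ} (hS : S.PosSemidef)
    (hcov : ∀ t : ι → ℝ, t ⬝ᵥ S *ᵥ t = ∫ v, (t ⬝ᵥ ofLp (h v)) ^ 2 ∂Q) :
    TendstoInDistribution (fun (n : ℕ) ω => √(n : ℝ) • sampleMean w h (n, ω)) atTop
      (id : EuclideanSpace ℝ ι → EuclideanSpace ℝ ι) (fun _ => μ)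
      (multivariateGaussian 0 S) where
  forall_aemeasurable n := (hw.measurable_sqrt_smul_sampleMean hm n).aemeasurable
  aemeasurable_limit := aemeasurable_id
  tendsto := by
    refine ProbabilityMeasure.tendsto_iff_tendsto_charFun.2 fun t => ?_
    have hinner : ∀ x : EuclideanSpace ℝ ι, inner ℝ x t = ofLp t ⬝ᵥ ofLp x := fun x => by
      simp [PiLp.inner_apply, dotProduct]
    -- The Cramér–Wold device: the characteristic function of the vector at `t` is that of the
    -- scalar projection on `t` at `1`, which reduces the claim to the scalar central limit theorem.
    let X : ℕ → Ω → ℝ := fun i ω => ofLp t ⬝ᵥ ofLp (h (w i ω))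
    have hgm : Measurable fun v => ofLp t ⬝ᵥ ofLp (h v) := by
      simp only [← hinner]
      fun_prop
    have hgL : MemLp (fun v => ofLp t ⬝ᵥ ofLp (h v)) 2 Q := by
      simp only [← hinner]
      exact hL.inner_const t
    have hX0 : MemLp (X 0) 2 μ := hgL.comp_measurePreserving (hw.measurePreserving 0)
    have hmean : ∫ ω, X 0 ω ∂μ = 0 := by
      rw [hw.integral_eq hgm.aestronglyMeasurable 0, h0]
    have hvar : variance (X 0) μ = ofLp t ⬝ᵥ S *ᵥ ofLp t := by
      rw [variance_of_integral_eq_zero hX0.1.aemeasurable hmean, hcov]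
      exact hw.integral_eq (hgm.pow_const 2).aestronglyMeasurable 0
    have hclt := tendstoInDistribution_inv_sqrt_mul_sum_sub (P := μ) (X := X)
      (Y := id) (P' := gaussianReal 0 (variance (X 0) μ).toNNReal)
      ⟨aemeasurable_id, Measure.map_id⟩ hX0
      (hw.indep.comp (fun _ v => ofLp t ⬝ᵥ ofLp (h v)) fun _ => hgm)
      (fun i => IdentDistrib.comp (u := fun v => ofLp t ⬝ᵥ ofLp (h v))
        ⟨(hw.measurable i).aemeasurable, (hw.measurable 0).aemeasurable,
          by rw [hw.law, hw.law]⟩ hgm)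
    have hchar := ProbabilityMeasure.tendsto_iff_tendsto_charFun.1 hclt.tendsto 1
    have hlim : charFun ((multivariateGaussian (0 : EuclideanSpace ℝ ι) S).map id) t =
        charFun ((gaussianReal 0 (variance (X 0) μ).toNNReal).map id) 1 := by
      have h5 : 0 ≤ variance (X 0) μ := variance_nonneg _ _
      rw [Measure.map_id, Measure.map_id, charFun_multivariateGaussian hS, charFun_gaussianReal]
      simp [hvar, hvar ▸ h5]
    have hpre : ∀ n : ℕ, charFun (μ.map fun ω => √(n : ℝ) • sampleMean w h (n, ω)) t =
        charFun (μ.map fun ω =>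
          (√(n : ℝ))⁻¹ * (∑ k ∈ Finset.range n, X k ω - n * ∫ ω, X 0 ω ∂μ)) 1 := by
      intro n
      have hXm : ∀ i, Measurable (X i) := fun i => hgm.comp (hw.measurable i)
      have hZm := hw.measurable_sqrt_smul_sampleMean hm n
      rw [charFun_apply, charFun_apply, integral_map hZm.aemeasurable (by fun_prop),
        integral_map (by fun_prop) (by fun_prop)]
      refine integral_congr_ae (Eventually.of_forall fun ω => ?_)
      have h6 : inner ℝ (√(n : ℝ) • sampleMean w h (n, ω)) t =
          (√(n : ℝ))⁻¹ * ∑ k ∈ Finset.range n, X k ω := by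
        rw [sqrt_smul_sampleMean, real_inner_smul_left, sum_inner]
        simp only [hinner, X]
      simp only [h6, hmean]
      simp
    simp only [ProbabilityMeasure.coe_mk] at hchar ⊢
    rw [hlim]
    exact hchar.congr fun n => (hpre n).symm

/-- Variances of independent summands add. Only an inequality holds uniformly in `n`, because the
left side is zero for `n = 0`. -/
theorem IsIID.integral_sqrt_mul_sampleMean_sq_le (hw : IsIID μ Q w) {h : V → ℝ}
    (hm : Measurable h) (hL : MemLp h 2 Q) (h0 : ∫ v, h v ∂Q = 0) (n : ℕ) :
    ∫ ω, (√(n : ℝ) * sampleMean w h (n, ω)) ^ 2 ∂μ ≤ ∫ v, h v ^ 2 ∂Q := by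
  have hLi : ∀ i, MemLp (fun ω => h (w i ω)) 2 μ := fun i =>
    hL.comp_measurePreserving (hw.measurePreserving i)
  have hmean : ∀ i, ∫ ω, h (w i ω) ∂μ = 0 := fun i => by
    rw [hw.integral_eq hm.aestronglyMeasurable i, h0]
  have hsum : ∫ ω, (∑ i ∈ Finset.range n, h (w i ω)) ^ 2 ∂μ = n * ∫ v, h v ^ 2 ∂Q := by
    have h1 : ∫ ω, (∑ i ∈ Finset.range n, fun ω => h (w i ω)) ω ∂μ = 0 := by
      simp only [Finset.sum_apply]
      rw [integral_finsetSum _ fun i _ => (hLi i).integrable (by norm_num)]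
      simp [hmean]
    have h2 := IndepFun.variance_sum (μ := μ) (X := fun i ω => h (w i ω))
      (s := Finset.range n) (fun i _ => hLi i)
      (fun i _ j _ hij => (hw.indep.indepFun hij).comp hm hm)
    rw [variance_of_integral_eq_zero
      (memLp_finsetSum' _ fun i _ => hLi i).1.aemeasurable h1] at h2
    simp only [Finset.sum_apply] at h2
    rw [h2, Finset.sum_congr rfl fun i _ => (variance_of_integral_eq_zero
      (hLi i).1.aemeasurable (hmean i)).trans
        (hw.integral_eq (hm.pow_const 2).aestronglyMeasurable i)]
    simp
  have h3 : ∀ ω, (√(n : ℝ) * sampleMean w h (n, ω)) ^ 2 =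
      (n : ℝ)⁻¹ * (∑ i ∈ Finset.range n, h (w i ω)) ^ 2 := fun ω => by
    have h4 := sqrt_smul_sampleMean (w := w) h n ω
    simp only [smul_eq_mul] at h4
    rw [h4, mul_pow, inv_pow, Real.sq_sqrt (Nat.cast_nonneg n)]
  simp only [h3]
  rw [integral_const_mul, hsum, ← mul_assoc]
  refine mul_le_of_le_one_left (integral_nonneg fun v => sq_nonneg _) ?_
  rcases eq_or_ne (n : ℝ) 0 with h | h
  · simp [h]
  · rw [inv_mul_cancel₀ h]

/-- Centred sample means are bounded in probability at the rate `√n`. -/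
theorem IsIID.boundedInProb_sqrt_mul_sampleMean (hw : IsIID μ Q w) {h : ι → V → ℝ}
    (hm : ∀ i, Measurable (h i)) (hL : ∀ i, MemLp (h i) 2 Q) (h0 : ∀ i, ∫ v, h i v ∂Q = 0) :
    BoundedInProb μ fun (n : ℕ) ω =>
      (toLp 2 fun i => √(n : ℝ) * sampleMean w (h i) (n, ω) : EuclideanSpace ℝ ι) := by
  have hLn : ∀ (n : ℕ) i, MemLp (fun ω => √(n : ℝ) * sampleMean w (h i) (n, ω)) 2 μ := fun n i =>
    MemLp.const_mul (MemLp.const_mul (memLp_finsetSum (Finset.range n)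
      (f := fun j ω => h i (w j ω)) fun j _ =>
        (hL i).comp_measurePreserving (hw.measurePreserving j)) ((n : ℝ)⁻¹)) (√(n : ℝ))
  refine BoundedInProb.of_memLp (c := ∑ i, ∫ v, h i v ^ 2 ∂Q)
    (fun n => MemLp.of_eval_piLp (hLn n)) fun n => ?_
  simp only [EuclideanSpace.real_norm_sq_eq]
  rw [integral_finsetSum _ fun i _ => (hLn n i).integrable_sq]
  exact Finset.sum_le_sum fun i _ => hw.integral_sqrt_mul_sampleMean_sq_le (hm i) (hL i) (h0 i) n

end CentralLimit

/-! ### Matrices and asymptotic expansions -/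

section Expansion

variable {X ι τ : Type*} [Fintype ι] [Fintype τ] {l : Filter X}

theorem isLittleO_mulVec_of_tendsto_zero {G : Type*} [NormedAddCommGroup G]
    {A : X → Matrix ι τ ℝ} {u : X → τ → ℝ} {v : X → G} (hA : Tendsto A l (𝓝 0))
    (hu : u =O[l] v) : (fun x => A x *ᵥ u x) =o[l] v := by
  rw [isLittleO_pi]
  intro i
  simp only [mulVec, dotProduct]
  refine IsLittleO.fun_sum fun j _ => ?_
  have h1 : Tendsto (fun x => A x i j) l (𝓝 0) :=
    ((continuous_id.matrix_elem i j).tendsto (0 : Matrix ι τ ℝ)).comp hA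
  have h2 := ((isLittleO_one_iff ℝ).2 h1).mul_isBigO ((isBigO_pi.1 hu j).norm_right)
  simpa using h2

theorem isBigO_mulVec (A : Matrix ι τ ℝ) (u : X → τ → ℝ) : (fun x => A *ᵥ u x) =O[l] u :=
  (LinearMap.toContinuousLinearMap A.mulVecLin).isBigO_comp u l

theorem tendsto_matrix_mul {ρ : Type*} {A : X → Matrix ρ ι ℝ} {A₀ : Matrix ρ ι ℝ}
    {M : X → Matrix ι τ ℝ} {M₀ : Matrix ι τ ℝ} (hA : Tendsto A l (𝓝 A₀))
    (hM : Tendsto M l (𝓝 M₀)) : Tendsto (fun x => A x * M x) l (𝓝 (A₀ * M₀)) := by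
  have h : Continuous fun N : Matrix ρ ι ℝ × Matrix ι τ ℝ => N.1 * N.2 :=
    continuous_fst.matrix_mul continuous_snd
  exact (h.tendsto (A₀, M₀)).comp (hA.prodMk_nhds hM)

theorem tendsto_matrix_transpose {A : X → Matrix ι τ ℝ} {A₀ : Matrix ι τ ℝ}
    (hA : Tendsto A l (𝓝 A₀)) : Tendsto (fun x => (A x)ᵀ) l (𝓝 A₀ᵀ) :=
  (continuous_id.matrix_transpose.tendsto A₀).comp hA

theorem tendsto_blockDiagonal {S : Type*} [DecidableEq S] {A : X → S → Matrix ι τ ℝ}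
    {A₀ : S → Matrix ι τ ℝ} (hA : ∀ s, Tendsto (fun x => A x s) l (𝓝 (A₀ s))) :
    Tendsto (fun x => blockDiagonal (A x)) l (𝓝 (blockDiagonal A₀)) := by
  refine tendsto_pi_nhds.2 fun i => tendsto_pi_nhds.2 fun j => ?_
  simp only [blockDiagonal_apply]
  split_ifs
  · exact tendsto_pi_nhds.1 (tendsto_pi_nhds.1 (hA i.2) i.1) j.1
  · exact tendsto_const_nhds

/-- Absorption: the unknown error `y` may appear in its own remainder, since a small multiple of it
can be moved to the left. Both the estimating equations and the least squares fit are solved for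
their errors in this way. -/
theorem isLittleO_sub_of_isLittleO_add {E G : Type*} [NormedAddCommGroup E]
    [NormedAddCommGroup G] {y v : X → E} {z : X → G} (hv : v =O[l] z)
    (h : (fun x => y x - v x) =o[l] fun x => ‖z x‖ + ‖y x‖) :
    (fun x => y x - v x) =o[l] z := by
  refine h.trans_isBigO ?_
  obtain ⟨c, hc⟩ := hv.bound
  -- From `‖y‖ ≤ (‖z‖ + ‖y‖) / 2 + c ‖z‖` follows `‖y‖ ≤ (2c + 1) ‖z‖`; adding `‖z‖` gives the
  -- constant.
  refine IsBigO.of_bound (2 * c + 2) ?_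
  filter_upwards [hc, h.bound (show (0 : ℝ) < 1 / 2 by norm_num)] with x hx hx'
  have h0 : 0 ≤ ‖z x‖ + ‖y x‖ := by positivity
  rw [Real.norm_of_nonneg h0] at hx' ⊢
  have h1 : ‖y x‖ ≤ ‖y x - v x‖ + ‖v x‖ := by simpa using norm_add_le (y x - v x) (v x)
  linarith

variable [DecidableEq τ]

theorem toLp_eq_sum_single (v : τ → ℝ) :
    (toLp 2 v : EuclideanSpace ℝ τ) = ∑ c, v c • EuclideanSpace.single c (1 : ℝ) := by
  ext c
  simp [Finset.sum_apply, Pi.single_apply]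

theorem jacobian_mulVec (f : EuclideanSpace ℝ τ → ι → ℝ) (x : EuclideanSpace ℝ τ) (v : τ → ℝ)
    (i : ι) : (jacobian f x *ᵥ v) i = fderiv ℝ (fun y => f y i) x (toLp 2 v) := by
  rw [toLp_eq_sum_single, map_sum]
  simp [mulVec, dotProduct, jacobian, mul_comm]

theorem tendsto_jacobian {f : EuclideanSpace ℝ τ → ι → ℝ} {y₀ : EuclideanSpace ℝ τ}
    (hf : ∀ i, ContDiffAt ℝ 1 (fun y => f y i) y₀) {y : X → EuclideanSpace ℝ τ}
    (hy : Tendsto y l (𝓝 y₀)) :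
    Tendsto (fun x => jacobian f (y x)) l (𝓝 (jacobian f y₀)) := by
  refine tendsto_pi_nhds.2 fun i => tendsto_pi_nhds.2 fun c => ?_
  have h1 : ContinuousAt (fderiv ℝ fun y => f y i) y₀ :=
    ((hf i).fderiv_right (m := 0) (by simp)).continuousAt
  exact (h1.clm_apply continuousAt_const).tendsto.comp hy

theorem isLittleO_sub_jacobian_mulVec {f : EuclideanSpace ℝ τ → ι → ℝ} {y₀ : EuclideanSpace ℝ τ}
    (hf : ∀ i, ContDiffAt ℝ 1 (fun y => f y i) y₀) {y : X → EuclideanSpace ℝ τ}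
    (hy : Tendsto y l (𝓝 y₀)) :
    (fun x => f (y x) - f y₀ - jacobian f y₀ *ᵥ (ofLp (y x) - ofLp y₀)) =o[l]
      fun x => ofLp (y x) - ofLp y₀ := by
  rw [isLittleO_pi]
  intro i
  have h1 := (((hf i).differentiableAt (by simp)).hasFDerivAt.isLittleO).comp_tendsto hy
  have h2 : (fun x => y x - y₀) =O[l] fun x => ofLp (y x) - ofLp y₀ :=
    ((PiLp.continuousLinearEquiv 2 ℝ (fun _ : τ => ℝ)).symm :
      (τ → ℝ) →L[ℝ] EuclideanSpace ℝ τ).isBigO_comp (fun x => ofLp (y x) - ofLp y₀) l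
  refine (h1.trans_isBigO h2).congr_left fun x => ?_
  simp only [Pi.sub_apply, jacobian_mulVec, Function.comp]
  rfl

theorem tendsto_matrix_inv [DecidableEq ι] {A : X → Matrix ι ι ℝ} {A₀ : Matrix ι ι ℝ}
    (h₀ : IsUnit A₀.det) (hA : Tendsto A l (𝓝 A₀)) : Tendsto (fun x => (A x)⁻¹) l (𝓝 A₀⁻¹) := by
  refine (continuousAt_matrix_inv A₀ ?_).tendsto.comp hA
  simpa [Ring.inverse_eq_inv'] using continuousAt_inv₀ h₀.ne_zero

/-- The quadratic form is the squared Euclidean norm of `A^{1/2} u`, and `A^{1/2}` is invertible. -/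
theorem tendsto_zero_of_dotProduct_mulVec [DecidableEq ι] {A : Matrix ι ι ℝ} (hA : A.PosDef)
    {u : X → ι → ℝ} (hu : Tendsto (fun x => u x ⬝ᵥ A *ᵥ u x) l (𝓝 0)) :
    Tendsto u l (𝓝 0) := by
  have hsq : CFC.sqrt A * CFC.sqrt A = A := CFC.sqrt_mul_sqrt_self A hA.posSemidef.nonneg
  have hsymm : (CFC.sqrt A)ᵀ = CFC.sqrt A := by
    have h := (CFC.sqrt_nonneg A).isSelfAdjoint.star_eq
    rwa [star_eq_conjTranspose, conjTranspose_eq_transpose_of_trivial] at h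
  have hdet : IsUnit (CFC.sqrt A).det := by
    refine isUnit_of_mul_isUnit_left (y := (CFC.sqrt A).det) ?_
    rw [← det_mul, hsq]
    exact hA.det_pos.ne'.isUnit
  have hnorm : ∀ x, u x ⬝ᵥ A *ᵥ u x = ∑ i, (CFC.sqrt A *ᵥ u x) i ^ 2 := fun x => by
    have h1 : u x ⬝ᵥ A *ᵥ u x = (CFC.sqrt A *ᵥ u x) ⬝ᵥ (CFC.sqrt A *ᵥ u x) := by
      conv_lhs => rw [← hsq, ← mulVec_mulVec, dotProduct_mulVec, ← mulVec_transpose, hsymm]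
    rw [h1, dotProduct]
    exact Finset.sum_congr rfl fun i _ => (sq _).symm
  have h2 : Tendsto (fun x => CFC.sqrt A *ᵥ u x) l (𝓝 0) := by
    refine tendsto_pi_nhds.2 fun i => ?_
    have h3 : Tendsto (fun x => √(u x ⬝ᵥ A *ᵥ u x)) l (𝓝 0) := by
      have h := (Real.continuous_sqrt.tendsto 0).comp hu
      rwa [Real.sqrt_zero] at h
    refine squeeze_zero_norm (fun x => ?_) h3
    refine Real.le_sqrt_of_sq_le ?_
    rw [hnorm, Real.norm_eq_abs, sq_abs]
    exact Finset.single_le_sum (f := fun i => (CFC.sqrt A *ᵥ u x) i ^ 2)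
      (fun i _ => sq_nonneg _) (Finset.mem_univ i)
  have h4 : Tendsto (fun x => (CFC.sqrt A)⁻¹ *ᵥ (CFC.sqrt A *ᵥ u x)) l (𝓝 0) := by
    have h5 : Continuous fun v : ι → ℝ => (CFC.sqrt A)⁻¹ *ᵥ v := by fun_prop
    have h := (h5.tendsto 0).comp h2
    rwa [mulVec_zero] at h
  refine h4.congr fun x => ?_
  rw [mulVec_mulVec, nonsing_inv_mul _ hdet, one_mulVec]

theorem inv_blockDiagonal {S : Type*} [Fintype S] [DecidableEq S] [DecidableEq ι]
    {A : S → Matrix ι ι ℝ} (hA : ∀ s, IsUnit (A s).det) :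
    (blockDiagonal A)⁻¹ = blockDiagonal fun s => (A s)⁻¹ := by
  refine inv_eq_right_inv ?_
  rw [← blockDiagonal_mul, ← blockDiagonal_one]
  congr 1
  exact funext fun s => mul_nonsing_inv _ (hA s)

end Expansion

/-! ### The least squares fit of the extrapolant -/

section LeastSquares

variable {𝒴 𝒵 κ : Type*} [MeasurableSpace 𝒴] [MeasurableSpace 𝒵] {k p d m R : ℕ}
  {pr : Problem 𝒴 𝒵 k p d m R κ} {C : Matrix (Fin R × Fin d) (Fin R × Fin d) ℝ}

/-- The normal equations of the least squares fit. -/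
theorem fitJacobian_transpose_mulVec_eq_zero (hC : C.PosDef) {theta : Fin R → Vec d}
    {gam : Vec m} (hG : ∀ i, DifferentiableAt ℝ (fun y => gridFit pr y i) gam)
    (hmin : IsLocalMin (criterion pr C theta) gam) :
    (fitJacobian pr gam)ᵀ *ᵥ (C⁻¹ *ᵥ fun i => theta i.1 i.2 - gridFit pr gam i) = 0 := by
  set res : Fin R × Fin d → ℝ := fun i => theta i.1 i.2 - gridFit pr gam i with hres
  have hsymm : ∀ i j, C⁻¹ i j = C⁻¹ j i := fun i j => by
    simpa using hC.inv.isHermitian.apply j i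
  have hd : ∀ i, HasFDerivAt (fun y => theta i.1 i.2 - gridFit pr y i)
      (-fderiv ℝ (fun y => gridFit pr y i) gam) gam := fun i =>
    (hG i).hasFDerivAt.const_sub _
  have hcrit : criterion pr C theta = fun y => ∑ i, (theta i.1 i.2 - gridFit pr y i) *
      ∑ j, C⁻¹ i j * (theta j.1 j.2 - gridFit pr y j) := rfl
  have hder : HasFDerivAt (criterion pr C theta)
      (∑ i, (res i • ∑ j, C⁻¹ i j • (-fderiv ℝ (fun y => gridFit pr y j) gam) +
        (∑ j, C⁻¹ i j * res j) • (-fderiv ℝ (fun y => gridFit pr y i) gam))) gam := by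
    rw [hcrit]
    exact HasFDerivAt.fun_sum fun i _ => (hd i).mul
      (HasFDerivAt.fun_sum fun j _ => (hd j).const_mul _)
  have h0 := hmin.hasFDerivAt_eq_zero hder
  funext c
  have h1 := congrArg (fun T => T (EuclideanSpace.single c (1 : ℝ))) h0
  have hJ : ∀ i, fderiv ℝ (fun y => gridFit pr y i) gam (EuclideanSpace.single c 1) =
      fitJacobian pr gam i c := fun i => rfl
  simp only [_root_.sum_apply, _root_.add_apply, _root_.smul_apply, _root_.neg_apply, hJ,
    smul_eq_mul, _root_.zero_apply, Finset.sum_add_distrib] at h1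
  -- By symmetry of `C⁻¹` the two terms of the product rule coincide.
  have h2 : ∑ i, res i * ∑ j, C⁻¹ i j * -fitJacobian pr gam j c =
      ∑ i, (∑ j, C⁻¹ i j * res j) * -fitJacobian pr gam i c := by
    simp only [Finset.mul_sum, Finset.sum_mul]
    rw [Finset.sum_comm]
    refine Finset.sum_congr rfl fun i _ => Finset.sum_congr rfl fun j _ => ?_
    rw [hsymm j i]
    ring
  rw [h2] at h1
  have h3 : ∑ i, (∑ j, C⁻¹ i j * res j) * -fitJacobian pr gam i c =
      -((fitJacobian pr gam)ᵀ *ᵥ (C⁻¹ *ᵥ res)) c := by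
    simp only [mulVec, dotProduct, transpose_apply]
    rw [← Finset.sum_neg_distrib]
    exact Finset.sum_congr rfl fun i _ => by ring
  rw [h3] at h1
  rw [Pi.zero_apply]
  linarith

variable {X : Type*} {l : Filter X} {theta₀ : Fin R → Vec d} {gam₀ : Vec m}
  {theta : X → Fin R → Vec d} {gam : X → Vec m}

/-- Consistency of the least squares fit. -/
theorem tendsto_leastSquares (hC : C.PosDef) (hfit : ∀ r, pr.G (pr.grid r) gam₀ = theta₀ r)
    (hmem : gam₀ ∈ pr.gammaSet)
    (hsep : ∀ ε > 0, ∃ δ > 0, ∀ g ∈ pr.gammaSet, ε ≤ dist g gam₀ →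
      ∃ r, δ ≤ dist (pr.G (pr.grid r) g) (theta₀ r))
    (hθ : ∀ r, Tendsto (fun x => theta x r) l (𝓝 (theta₀ r)))
    (hmin : ∀ᶠ x in l, gam x ∈ pr.gammaSet ∧
      IsMinOn (criterion pr C (theta x)) pr.gammaSet (gam x)) :
    Tendsto gam l (𝓝 gam₀) := by
  have hcoord : ∀ i : Fin R × Fin d,
      Tendsto (fun x => theta x i.1 i.2) l (𝓝 (theta₀ i.1 i.2)) := fun i =>
    ((EuclideanSpace.proj i.2 : Vec d →L[ℝ] ℝ).continuous.tendsto _).comp (hθ i.1)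
  have hup : Tendsto (fun x => criterion pr C (theta x) gam₀) l (𝓝 0) := by
    have h1 : Continuous fun u : Fin R × Fin d → ℝ => u ⬝ᵥ C⁻¹ *ᵥ u := by fun_prop
    have h2 : Tendsto (fun x => fun i : Fin R × Fin d => theta x i.1 i.2 - gridFit pr gam₀ i) l
        (𝓝 0) := by
      refine tendsto_pi_nhds.2 fun i => ?_
      simpa [gridFit, hfit] using (hcoord i).sub_const (theta₀ i.1 i.2)
    have h := (h1.tendsto 0).comp h2
    rwa [zero_dotProduct] at h
  -- Minimality squeezes the criterion at the fit between zero and its value at `gam₀`. No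
  -- compactness of the parameter set is needed.
  have hcr : Tendsto (fun x => criterion pr C (theta x) (gam x)) l (𝓝 0) := by
    refine tendsto_of_tendsto_of_tendsto_of_le_of_le' tendsto_const_nhds hup
      (Eventually.of_forall fun x => ?_) (hmin.mono fun x hx => hx.2 hmem)
    simpa [criterion] using hC.inv.posSemidef.dotProduct_mulVec_nonneg
      (fun i => theta x i.1 i.2 - gridFit pr (gam x) i)
  have hres := tendsto_zero_of_dotProduct_mulVec hC.inv hcr
  have hG : ∀ r, Tendsto (fun x => pr.G (pr.grid r) (gam x)) l (𝓝 (theta₀ r)) := fun r => by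
    have h3 : ∀ a, Tendsto (fun x => pr.G (pr.grid r) (gam x) a) l (𝓝 (theta₀ r a)) :=
      fun a => by
        have h4 := (hcoord (r, a)).sub (tendsto_pi_nhds.1 hres (r, a))
        simpa [gridFit] using h4
    exact ((PiLp.continuous_toLp 2 fun _ : Fin d => ℝ).tendsto _).comp (tendsto_pi_nhds.2 h3)
  rw [Metric.tendsto_nhds]
  intro ε hε
  obtain ⟨δ, hδ, hsep⟩ := hsep ε hε
  have h5 : ∀ᶠ x in l, ∀ r, dist (pr.G (pr.grid r) (gam x)) (theta₀ r) < δ :=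
    eventually_all.2 fun r => Metric.tendsto_nhds.1 (hG r) δ hδ
  filter_upwards [h5, hmin] with x hx hx'
  by_contra hc
  obtain ⟨r, hr⟩ := hsep _ hx'.1 (not_lt.1 hc)
  exact absurd (hx r) (not_lt.2 hr)

/-- The asymptotic expansion of the least squares fit. -/
theorem isLittleO_leastSquares (hC : C.PosDef) (hfit : ∀ r, pr.G (pr.grid r) gam₀ = theta₀ r)
    (hInt : gam₀ ∈ interior pr.gammaSet)
    (hsm : ∀ r, ContDiffAt ℝ 1 (pr.G (pr.grid r)) gam₀)
    (hgram : IsUnit (gramMatrix pr C gam₀).det)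
    (hmin : ∀ᶠ x in l, gam x ∈ pr.gammaSet ∧
      IsMinOn (criterion pr C (theta x)) pr.gammaSet (gam x))
    (hgam : Tendsto gam l (𝓝 gam₀)) :
    (fun x => ofLp (gam x) - ofLp gam₀ -
      ((gramMatrix pr C gam₀)⁻¹ * (fitJacobian pr gam₀)ᵀ * C⁻¹) *ᵥ
        fun i : Fin R × Fin d => theta x i.1 i.2 - theta₀ i.1 i.2) =o[l]
      fun x => fun i : Fin R × Fin d => theta x i.1 i.2 - theta₀ i.1 i.2 := by
  set z : X → Fin R × Fin d → ℝ := fun x i => theta x i.1 i.2 - theta₀ i.1 i.2 with hz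
  set y : X → Fin m → ℝ := fun x => ofLp (gam x) - ofLp gam₀ with hy
  set J := fitJacobian pr gam₀ with hJ
  set N : X → Matrix (Fin m) (Fin R × Fin d) ℝ := fun x => (fitJacobian pr (gam x))ᵀ * C⁻¹
  have hsm' : ∀ i, ContDiffAt ℝ 1 (fun g => gridFit pr g i) gam₀ := fun i =>
    (EuclideanSpace.proj i.2 : Vec d →L[ℝ] ℝ).contDiff.contDiffAt.comp gam₀ (hsm i.1)
  have hexp : (fun x => gridFit pr (gam x) - gridFit pr gam₀ - J *ᵥ y x) =o[l] y :=
    isLittleO_sub_jacobian_mulVec hsm' hgam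
  have hN : Tendsto (fun x => N x - Jᵀ * C⁻¹) l (𝓝 0) := by
    have h1 : Tendsto (fun x => fitJacobian pr (gam x)) l (𝓝 J) := tendsto_jacobian hsm' hgam
    have h2 : Continuous fun A : Matrix (Fin R × Fin d) (Fin m) ℝ => Aᵀ * C⁻¹ - Jᵀ * C⁻¹ := by
      fun_prop
    have h := (h2.tendsto J).comp h1
    rwa [sub_self] at h
  -- The normal equations at the fit itself, which is eventually interior. The residual is written
  -- as an increment from the population, where the fit is exact.
  have hfoc : ∀ᶠ x in l, N x *ᵥ (z x - (gridFit pr (gam x) - gridFit pr gam₀)) = 0 := by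
    have h1 : ∀ᶠ g in 𝓝 gam₀, ∀ i, DifferentiableAt ℝ (fun g => gridFit pr g i) g :=
      eventually_all.2 fun i => ((hsm' i).eventually (by simp)).mono fun g hg =>
        hg.differentiableAt (by simp)
    have h2 : ∀ᶠ g in 𝓝 gam₀, g ∈ interior pr.gammaSet := isOpen_interior.mem_nhds hInt
    filter_upwards [hmin, hgam.eventually h1, hgam.eventually h2] with x hx hx1 hx2
    have h3 := fitJacobian_transpose_mulVec_eq_zero hC hx1
      (hx.2.isLocalMin (mem_interior_iff_mem_nhds.1 hx2))
    rw [mulVec_mulVec] at h3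
    refine Eq.trans (congrArg (N x *ᵥ ·) (funext fun i => ?_)) h3
    simp [hz, gridFit, hfit]
  have hy' : y =O[l] fun x => ‖z x‖ + ‖y x‖ := IsBigO.of_bound 1
    (Eventually.of_forall fun x => by
      rw [one_mul, Real.norm_of_nonneg (by positivity)]
      exact le_add_of_nonneg_left (norm_nonneg _))
  have hz' : z =O[l] fun x => ‖z x‖ + ‖y x‖ := IsBigO.of_bound 1
    (Eventually.of_forall fun x => by
      rw [one_mul, Real.norm_of_nonneg (by positivity)]
      exact le_add_of_nonneg_right (norm_nonneg _))
  have hρ := hexp.trans_isBigO hy'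
  have hres : (fun x => z x - (gridFit pr (gam x) - gridFit pr gam₀)) =O[l]
      fun x => ‖z x‖ + ‖y x‖ := by
    refine (hz'.sub (hρ.isBigO.add ((isBigO_mulVec J y).trans hy'))).congr_left fun x => ?_
    abel
  have hNres := isLittleO_mulVec_of_tendsto_zero hN hres
  -- One continuous derivative suffices: the change of the Jacobian is `o(1)` and multiplies a
  -- residual that is itself of the order of the errors.
  refine isLittleO_sub_of_isLittleO_add (isBigO_mulVec _ z) ?_
  have hmain : (fun x => (gramMatrix pr C gam₀)⁻¹ *ᵥ
      ((N x - Jᵀ * C⁻¹) *ᵥ (z x - (gridFit pr (gam x) - gridFit pr gam₀)) -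
        (Jᵀ * C⁻¹) *ᵥ (gridFit pr (gam x) - gridFit pr gam₀ - J *ᵥ y x))) =o[l]
      fun x => ‖z x‖ + ‖y x‖ :=
    (isBigO_mulVec _ _).trans_isLittleO
      (hNres.sub ((isBigO_mulVec _ _).trans_isLittleO hρ))
  refine hmain.congr' ?_ EventuallyEq.rfl
  filter_upwards [hfoc] with x hx
  have hgr : gramMatrix pr C gam₀ = Jᵀ * C⁻¹ * J := rfl
  -- The increments of the fitted values cancel by the normal equations, leaving `Ω y - Jᵀ C⁻¹ z`.
  have h4 : (N x - Jᵀ * C⁻¹) *ᵥ (z x - (gridFit pr (gam x) - gridFit pr gam₀)) -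
      (Jᵀ * C⁻¹) *ᵥ (gridFit pr (gam x) - gridFit pr gam₀ - J *ᵥ y x) =
      gramMatrix pr C gam₀ *ᵥ y x - (Jᵀ * C⁻¹) *ᵥ z x := by
    rw [sub_mulVec, hx, hgr, ← mulVec_mulVec (y x) (Jᵀ * C⁻¹) J]
    simp only [mulVec_sub]
    abel
  rw [h4, mulVec_sub, mulVec_mulVec, nonsing_inv_mul _ hgram, one_mulVec, mulVec_mulVec,
    ← Matrix.mul_assoc]

end LeastSquares

/-! ### Consistency of roots of estimating equations -/

section Roots

variable {Ω V V' E F : Type*} [MeasurableSpace Ω] [MeasurableSpace V] [MeasurableSpace V']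
  {μ : Measure Ω} {Q : Measure V} {Q' : Measure V'} {w : ℕ → Ω → V}
  [NormedAddCommGroup E] [NormedSpace ℝ E] [FiniteDimensional ℝ E]
  [NormedAddCommGroup F] [NormedSpace ℝ F] [FiniteDimensional ℝ F] [MeasurableSpace F]
  [BorelSpace F]

theorem IsIID.comp (hw : IsIID μ Q w) {τ : V → V'} (hτ : MeasurePreserving τ Q Q') :
    IsIID μ Q' fun i ω => τ (w i ω) where
  measurable i := hτ.measurable.comp (hw.measurable i)
  indep := hw.indep.comp (fun _ => τ) fun _ => hτ.measurable
  law i := (hτ.comp (hw.measurePreserving i)).map_eq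

theorem RegularScore.aestronglyMeasurable {f : V → E → F} {K : Set E} {e₀ : E}
    (hf : RegularScore Q f K e₀) (e : E) : AEStronglyMeasurable (fun v => f v e) Q :=
  (hf.measurable e).aestronglyMeasurable

theorem RegularScore.integrable {f : V → E → F} {K : Set E} {e₀ : E}
    (hf : RegularScore Q f K e₀) : Integrable (fun v => f v e₀) Q := by
  obtain ⟨F₀, hF₀, hb⟩ := hf.dominated
  exact hF₀.mono' (hf.aestronglyMeasurable e₀)
    (hb.mono fun v hv => hv e₀ (interior_subset hf.mem_interior))

/-- A limit point of roots of the sample equations is a root of the population equation. -/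
theorem RegularScore.integral_eq_zero_of_tendsto [IsProbabilityMeasure μ] {f : V → E → F}
    {K : Set E} {e₀ e : E} (hf : RegularScore Q f K e₀) (hw : IsIID μ Q w)
    {l : Filter (ℕ × Ω)} [NeBot l] (hl : l ≤ inProb μ) {θ : ℕ × Ω → E} (he : e ∈ K)
    (hθ : Tendsto θ l (𝓝 e)) (hmem : ∀ᶠ x in l, θ x ∈ K)
    (hroot : ∀ᶠ x in l, sampleMean w (fun v => f v (θ x)) x = 0) : ∫ v, f v e ∂Q = 0 := by
  have h1 := hw.tendsto_sampleMean_apply he (fun e _ => hf.aestronglyMeasurable e)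
    hf.continuousOn hf.dominated hl (tendsto_nhdsWithin_iff.2 ⟨hθ, hmem⟩)
  exact tendsto_nhds_unique h1 (tendsto_const_nhds.congr' (hroot.mono fun x hx => hx.symm))

/-- Convergence in a compact set to the only possible limit along finer filters. -/
theorem tendsto_of_unique_clusterPt {l : Filter (ℕ × Ω)} {K : Set E} (hK : IsCompact K)
    {θ : ℕ × Ω → E} {e₀ : E} (hmem : ∀ᶠ x in l, θ x ∈ K)
    (h : ∀ e ∈ K, ∀ l' ≤ l, NeBot l' → Tendsto θ l' (𝓝 e) → e = e₀) :
    Tendsto θ l (𝓝 e₀) := by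
  refine hK.tendsto_nhds_of_unique_mapClusterPt hmem fun e he hcl => ?_
  -- A cluster point is a genuine limit along this finer filter, which is why the laws of large
  -- numbers are also available below `inProb μ`.
  refine h e he (l ⊓ comap θ (𝓝 e)) inf_le_left ?_ (tendsto_comap.mono_left inf_le_right)
  rw [neBot_inf_comap_iff_map, inf_comm]
  exact hcl

end Roots

/-! ### The stacked score -/

section Stacked

variable {𝒴 𝒵 κ S Ω : Type*} [MeasurableSpace 𝒴] [MeasurableSpace 𝒵] [MeasurableSpace Ω]
  {k p d m R B : ℕ} [Fintype S] [DecidableEq S] [Fintype κ] [DecidableEq κ]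
  {pr : Problem 𝒴 𝒵 k p d m R κ} {arm : Arm S k p d m R κ}

/-- The component `(Θ_{λ_r}, ξ)` of the stacked parameter. -/
def blockProj (s : S) (r : Fin R) :
    EuclideanSpace ℝ (StackIdx S k p d R κ) →L[ℝ] Vec d × Corr k p κ :=
  LinearMap.toContinuousLinearMap
    { toFun := fun t => (toLp 2 fun a => t (.inl ((r, a), s)), toLp 2 fun c => t (.inr c))
      map_add' := fun _ _ => rfl
      map_smul' := fun _ _ => rfl }

/-- The component `ξ` of the stacked parameter. -/
def corrProj : EuclideanSpace ℝ (StackIdx S k p d R κ) →L[ℝ] Corr k p κ :=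
  LinearMap.toContinuousLinearMap
    { toFun := fun t => toLp 2 fun c => t (.inr c)
      map_add' := fun _ _ => rfl
      map_smul' := fun _ _ => rfl }

/-- The stacked estimating function of the `b`-th replicate. -/
def replicateScore (pr : Problem 𝒴 𝒵 k p d m R κ) (arm : Arm S k p d m R κ) (b : Fin B)
    (w : Aug 𝒴 𝒵 k p B S) (t : EuclideanSpace ℝ (StackIdx S k p d R κ)) :
    StackIdx S k p d R κ → ℝ :=
  Sum.elim (fun i => score pr arm i.2 i.1.1 (w.1, w.2 b i.2) (blockProj i.2 i.1.1 t) i.1.2)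
    (fun c => pr.g w.1 (corrProj t) c)

/-- The component `g` does not involve the simulated noise, so averaging it over `B > 0` replicates
changes nothing. -/
theorem stackedScore_eq_average (hB : 0 < B) (w : Aug 𝒴 𝒵 k p B S)
    (t : EuclideanSpace ℝ (StackIdx S k p d R κ)) (i : StackIdx S k p d R κ) :
    stackedScore pr arm w t i = (B : ℝ)⁻¹ * ∑ b, replicateScore pr arm b w t i := by
  rcases i with i | c
  · rfl
  · have hB' : (B : ℝ) ≠ 0 := by positivity
    simp only [stackedScore, replicateScore, Sum.elim_inr, Finset.sum_const, Finset.card_univ,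
      Fintype.card_fin, nsmul_eq_mul]
    rw [inv_mul_cancel_left₀ hB']
    rfl

variable [IsProbabilityMeasure pr.P]

instance : IsProbabilityMeasure (augLaw pr B : Measure (Aug 𝒴 𝒵 k p B S)) := by
  unfold augLaw
  infer_instance

theorem measurePreserving_replicate (b : Fin B) (s : S) :
    MeasurePreserving (fun w : Aug 𝒴 𝒵 k p B S => (w.1, w.2 b s)) (augLaw pr B)
      (pr.P.prod (stdGaussian (Vec p))) :=
  (MeasurePreserving.id pr.P).prod
    ((measurePreserving_eval (fun _ : S => stdGaussian (Vec p)) s).comp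
      (measurePreserving_eval
        (fun _ : Fin B => Measure.pi fun _ : S => stdGaussian (Vec p)) b))

theorem measurePreserving_obs :
    MeasurePreserving (fun w : Aug 𝒴 𝒵 k p B S => w.1) (augLaw pr B) pr.P :=
  measurePreserving_fst

theorem blockProj_stack (theta : S → Fin R → Vec d) (xi : Corr k p κ) (s : S) (r : Fin R) :
    blockProj s r (stack theta xi) = (theta s r, xi) := rfl

theorem corrProj_stack (theta : S → Fin R → Vec d) (xi : Corr k p κ) :
    corrProj (stack theta xi) = xi := rfl

theorem locallyRegular_replicateScore (hpr : pr.Regular) (harm : arm.Regular pr B) (b : Fin B)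
    (i : StackIdx S k p d R κ) :
    LocallyRegular (augLaw pr B) (fun w t => replicateScore pr arm b w t i)
      (stack arm.theta pr.xi) := by
  rcases i with i | c
  · exact ((harm.score_regular i.2 i.1.1).locallyRegular (EuclideanSpace.proj i.1.2)
      (blockProj i.2 i.1.1) (blockProj_stack _ _ _ _)).comp_measurePreserving
        (measurePreserving_replicate b i.2)
  · exact (hpr.g_regular.locallyRegular (EuclideanSpace.proj c) (corrProj (S := S) (R := R) (d := d))
      (corrProj_stack arm.theta pr.xi)).comp_measurePreserving measurePreserving_obs

/-- The law of an observation with its noise vector is the same for every replicate. -/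
theorem integral_fderiv_replicateScore (harm : arm.Regular pr B)
    (b b' : Fin B) (i : StackIdx S k p d R κ) :
    ∫ w, fderiv ℝ (fun t => replicateScore pr arm b w t i) (stack arm.theta pr.xi)
        ∂(augLaw pr B : Measure (Aug 𝒴 𝒵 k p B S)) =
      ∫ w, fderiv ℝ (fun t => replicateScore pr arm b' w t i) (stack arm.theta pr.xi)
        ∂(augLaw pr B : Measure (Aug 𝒴 𝒵 k p B S)) := by
  rcases i with i | c
  · have h := (harm.score_regular i.2 i.1.1).locallyRegular (EuclideanSpace.proj i.1.2)
      (blockProj i.2 i.1.1) (blockProj_stack arm.theta pr.xi _ _)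
    exact (h.integral_fderiv_comp (measurePreserving_replicate b i.2)).trans
      (h.integral_fderiv_comp (measurePreserving_replicate b' i.2)).symm
  · rfl

theorem integral_replicateScore (hpr : pr.Regular) (harm : arm.Regular pr B) (b : Fin B)
    (i : StackIdx S k p d R κ) :
    ∫ w, replicateScore pr arm b w (stack arm.theta pr.xi) i
      ∂(augLaw pr B : Measure (Aug 𝒴 𝒵 k p B S)) = 0 := by
  rcases i with i | c
  · have hreg := harm.score_regular i.2 i.1.1
    have h1 := (EuclideanSpace.proj i.1.2 : Vec d →L[ℝ] ℝ).integral_comp_comm hreg.integrable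
    rw [hreg.unbiased, map_zero] at h1
    have hτ := measurePreserving_replicate (pr := pr) b i.2
    rw [← hτ.map_eq, integral_map hτ.measurable.aemeasurable (hτ.map_eq.symm ▸
      ((EuclideanSpace.proj i.1.2 : Vec d →L[ℝ] ℝ).continuous.comp_aestronglyMeasurable
        hreg.integrable.1))] at h1
    exact h1
  · have hreg := hpr.g_regular
    have h1 := (EuclideanSpace.proj c : Corr k p κ →L[ℝ] ℝ).integral_comp_comm hreg.integrable
    rw [hreg.unbiased, map_zero] at h1
    have hτ := measurePreserving_obs (pr := pr) (B := B) (S := S)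
    rw [← hτ.map_eq, integral_map hτ.measurable.aemeasurable (hτ.map_eq.symm ▸
      ((EuclideanSpace.proj c : Corr k p κ →L[ℝ] ℝ).continuous.comp_aestronglyMeasurable
        hreg.integrable.1))] at h1
    exact h1

theorem locallyRegular_stackedScore (hB : 0 < B) (hpr : pr.Regular) (harm : arm.Regular pr B)
    (i : StackIdx S k p d R κ) :
    LocallyRegular (augLaw pr B) (fun (w : Aug 𝒴 𝒵 k p B S) t => stackedScore pr arm w t i)
      (stack arm.theta pr.xi) := by
  simp only [stackedScore_eq_average hB]
  exact LocallyRegular.const_mul_sum (fun b => locallyRegular_replicateScore hpr harm b i) _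

theorem integral_fderiv_stackedScore (hB : 0 < B) (hpr : pr.Regular) (harm : arm.Regular pr B)
    (b : Fin B) (i : StackIdx S k p d R κ) :
    ∫ w, fderiv ℝ (fun t => stackedScore pr arm w t i) (stack arm.theta pr.xi)
        ∂(augLaw pr B : Measure (Aug 𝒴 𝒵 k p B S)) =
      ∫ w, fderiv ℝ (fun t => replicateScore pr arm b w t i) (stack arm.theta pr.xi)
        ∂(augLaw pr B : Measure (Aug 𝒴 𝒵 k p B S)) := by
  have hB' : (B : ℝ) ≠ 0 := by positivity
  simp only [stackedScore_eq_average hB]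
  rw [integral_fderiv_const_mul_sum (fun b => locallyRegular_replicateScore hpr harm b i)]
  simp only [integral_fderiv_replicateScore harm _ b]
  rw [Finset.sum_const, Finset.card_univ, Fintype.card_fin, ← Nat.cast_smul_eq_nsmul ℝ,
    smul_smul, inv_mul_cancel₀ hB', one_smul]

theorem breadMatrix_apply (hB : 0 < B) (hpr : pr.Regular) (harm : arm.Regular pr B)
    (i c : StackIdx S k p d R κ) :
    breadMatrix pr arm B i c =
      (∫ w, fderiv ℝ (fun t => stackedScore pr arm w t i) (stack arm.theta pr.xi)
        ∂(augLaw pr B : Measure (Aug 𝒴 𝒵 k p B S))) (EuclideanSpace.single c 1) := by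
  rw [ContinuousLinearMap.integral_apply
    (locallyRegular_stackedScore hB hpr harm i).integrable_fderiv]
  rfl

/-- Lets `𝒜`, defined from the averaged score, serve as the linearization of every single replicate.
-/
theorem breadMatrix_mulVec (hB : 0 < B) (hpr : pr.Regular) (harm : arm.Regular pr B)
    (b : Fin B) (v : StackIdx S k p d R κ → ℝ) (i : StackIdx S k p d R κ) :
    (breadMatrix pr arm B *ᵥ v) i =
      (∫ w, fderiv ℝ (fun t => replicateScore pr arm b w t i) (stack arm.theta pr.xi)
        ∂(augLaw pr B : Measure (Aug 𝒴 𝒵 k p B S))) (toLp 2 v) := by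
  rw [toLp_eq_sum_single, map_sum]
  simp only [mulVec, dotProduct, breadMatrix_apply hB hpr harm,
    integral_fderiv_stackedScore hB hpr harm b, map_smul, smul_eq_mul]
  exact Finset.sum_congr rfl fun c _ => mul_comm _ _

end Stacked

/-! ### The extrapolation step -/

section Extrapolation

variable {𝒴 𝒵 κ S X : Type*} [MeasurableSpace 𝒴] [MeasurableSpace 𝒵]
  {k p d m R B : ℕ} [Fintype S] [DecidableEq S] [Fintype κ] [DecidableEq κ]
  {pr : Problem 𝒴 𝒵 k p d m R κ} {arm : Arm S k p d m R κ} {l : Filter X}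

/-- The contribution to the extrapolated value of the estimation of weights with derivative `Da`. -/
def weightTerm (pr : Problem 𝒴 𝒵 k p d m R κ) (Da : Matrix S (CorrIdx k p κ) ℝ)
    (gam : S → Vec m) : Matrix (Fin d) (CorrIdx k p κ) ℝ :=
  of fun i c => ∑ s, pr.G (-1) (gam s) i * Da s c

/-- Block diagonal products and inverses are computed blockwise, so each series contributes its own
least squares expansion, scaled by its weight. -/
theorem extrapolationMatrix_apply {C : S → Matrix (Fin R × Fin d) (Fin R × Fin d) ℝ}
    {a : S → ℝ} {gam : S → Vec m} (hC : ∀ s, (C s).PosDef)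
    (hgram : ∀ s, IsUnit (gramMatrix pr (C s) (gam s)).det) (i : Fin d) (j : Fin R × Fin d)
    (s : S) :
    extrapolationMatrix pr C a gam i (j, s) = a s *
      (jacobian (fun y i => pr.G (-1) y i) (gam s) *
        ((gramMatrix pr (C s) (gam s))⁻¹ * (fitJacobian pr (gam s))ᵀ * (C s)⁻¹)) i j := by
  have h : extrapolationMatrix pr C a gam = averagingMatrix d a * blockDiagonal fun s =>
      jacobian (fun y i => pr.G (-1) y i) (gam s) *
        ((gramMatrix pr (C s) (gam s))⁻¹ * (fitJacobian pr (gam s))ᵀ * (C s)⁻¹) := by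
    rw [extrapolationMatrix, inv_blockDiagonal hgram,
      inv_blockDiagonal fun s => (hC s).det_pos.ne'.isUnit, blockDiagonal_transpose]
    simp only [blockDiagonal_mul, Matrix.mul_assoc]
  rw [h, mul_apply, Fintype.sum_prod_type]
  simp [averagingMatrix, blockDiagonal_apply]

theorem Arm.Regular.contDiffAt_gridFit (harm : arm.Regular pr B) (s : S) (i : Fin R × Fin d) :
    ContDiffAt ℝ 1 (fun y => gridFit pr y i) (arm.gamma s) :=
  (EuclideanSpace.proj i.2 : Vec d →L[ℝ] ℝ).contDiff.contDiffAt.comp (arm.gamma s)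
    (harm.G_smooth s i.1)

theorem Arm.Regular.contDiffAt_extrapolant (harm : arm.Regular pr B) (s : S) (i : Fin d) :
    ContDiffAt ℝ 1 (fun y => pr.G (-1) y i) (arm.gamma s) :=
  (EuclideanSpace.proj i : Vec d →L[ℝ] ℝ).contDiff.contDiffAt.comp (arm.gamma s)
    (harm.G_smooth_neg_one s)

theorem tendsto_extrapolationMatrix (harm : arm.Regular pr B) {a : X → S → ℝ} {a₀ : S → ℝ}
    (ha : Tendsto a l (𝓝 a₀)) {gam : X → S → Vec m}
    (hgam : ∀ s, Tendsto (fun x => gam x s) l (𝓝 (arm.gamma s))) :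
    Tendsto (fun x => extrapolationMatrix pr arm.C (a x) (gam x)) l
      (𝓝 (extrapolationMatrix pr arm.C a₀ arm.gamma)) := by
  have hJ : ∀ s, Tendsto (fun x => fitJacobian pr (gam x s)) l
      (𝓝 (fitJacobian pr (arm.gamma s))) := fun s =>
    tendsto_jacobian (harm.contDiffAt_gridFit s) (hgam s)
  have hG : ∀ s, Tendsto (fun x => jacobian (fun y i => pr.G (-1) y i) (gam x s)) l
      (𝓝 (jacobian (fun y i => pr.G (-1) y i) (arm.gamma s))) := fun s =>
    tendsto_jacobian (harm.contDiffAt_extrapolant s) (hgam s)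
  have hgram : ∀ s, Tendsto (fun x => gramMatrix pr (arm.C s) (gam x s)) l
      (𝓝 (gramMatrix pr (arm.C s) (arm.gamma s))) := fun s =>
    tendsto_matrix_mul (tendsto_matrix_mul (tendsto_matrix_transpose (hJ s)) tendsto_const_nhds)
      (hJ s)
  have hav : Tendsto (fun x => averagingMatrix d (a x)) l (𝓝 (averagingMatrix d a₀)) := by
    refine tendsto_pi_nhds.2 fun i => tendsto_pi_nhds.2 fun c => ?_
    simp only [averagingMatrix, of_apply]
    split_ifs
    · exact tendsto_pi_nhds.1 ha c.2
    · exact tendsto_const_nhds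
  have hdet : IsUnit (blockDiagonal fun s => gramMatrix pr (arm.C s) (arm.gamma s)).det := by
    rw [det_blockDiagonal]
    exact (Finset.prod_ne_zero_iff.2 fun s _ => (harm.gram_nonsingular s).ne_zero).isUnit
  have hinv := tendsto_matrix_inv hdet (tendsto_blockDiagonal hgram)
  exact tendsto_matrix_mul (tendsto_matrix_mul (tendsto_matrix_mul (tendsto_matrix_mul hav
    (tendsto_blockDiagonal hG)) hinv) (tendsto_matrix_transpose (tendsto_blockDiagonal hJ)))
      tendsto_const_nhds

theorem fromCols_mulVec_stack_sub (D : Matrix (Fin d) ((Fin R × Fin d) × S) ℝ)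
    (T : Matrix (Fin d) (CorrIdx k p κ) ℝ) (theta theta₀ : S → Fin R → Vec d)
    (xi xi₀ : Corr k p κ) (i : Fin d) :
    (fromCols D T *ᵥ (ofLp (stack theta xi) - ofLp (stack theta₀ xi₀))) i =
      (∑ s, ∑ j : Fin R × Fin d, D i (j, s) * (theta s j.1 j.2 - theta₀ s j.1 j.2)) +
        (T *ᵥ (ofLp xi - ofLp xi₀)) i := by
  simp only [mulVec, dotProduct, Fintype.sum_sum_type, fromCols_apply_inl, fromCols_apply_inr]
  rw [Fintype.sum_prod_type_right]
  rfl

/-- The extrapolated value is a differentiable function of the stacked parameter. -/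
theorem isLittleO_extrapolate (harm : arm.Regular pr B) {theta : X → S → Fin R → Vec d}
    {xi : X → Corr k p κ} {gam : X → S → Vec m} {a : X → S → ℝ} {a₀ : S → ℝ}
    {Da : Matrix S (CorrIdx k p κ) ℝ}
    (ha : ∀ x s, a x s - a₀ s = (Da *ᵥ (ofLp (xi x) - ofLp pr.xi)) s)
    (hmin : ∀ s, ∀ᶠ x in l, gam x s ∈ pr.gammaSet ∧
      IsMinOn (criterion pr (arm.C s) (theta x s)) pr.gammaSet (gam x s))
    (hgam : ∀ s, Tendsto (fun x => gam x s) l (𝓝 (arm.gamma s))) :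
    (fun x => ofLp (extrapolate pr (a x) (gam x)) - ofLp (extrapolate pr a₀ arm.gamma) -
      fromCols (extrapolationMatrix pr arm.C a₀ arm.gamma) (weightTerm pr Da arm.gamma) *ᵥ
        (ofLp (stack (theta x) (xi x)) - ofLp (stack arm.theta pr.xi))) =o[l]
      fun x => ofLp (stack (theta x) (xi x)) - ofLp (stack arm.theta pr.xi) := by
  set δ : X → StackIdx S k p d R κ → ℝ := fun x =>
    ofLp (stack (theta x) (xi x)) - ofLp (stack arm.theta pr.xi) with hδ
  let z : S → X → Fin R × Fin d → ℝ := fun s x i => theta x s i.1 i.2 - arm.theta s i.1 i.2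
  let ζ : X → CorrIdx k p κ → ℝ := fun x => ofLp (xi x) - ofLp pr.xi
  let N : S → Matrix (Fin m) (Fin R × Fin d) ℝ := fun s =>
    (gramMatrix pr (arm.C s) (arm.gamma s))⁻¹ * (fitJacobian pr (arm.gamma s))ᵀ * (arm.C s)⁻¹
  let J : S → Matrix (Fin d) (Fin m) ℝ := fun s =>
    jacobian (fun y i => pr.G (-1) y i) (arm.gamma s)
  let g : S → X → Fin d → ℝ := fun s x =>
    ofLp (pr.G (-1) (gam x s)) - ofLp (pr.G (-1) (arm.gamma s))
  have hz : ∀ s, z s =O[l] δ := fun s => isBigO_pi.2 fun i => IsBigO.of_bound 1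
    (Eventually.of_forall fun x => by
      rw [one_mul]
      exact norm_le_pi_norm (δ x) (.inl (i, s)))
  have hζ : ζ =O[l] δ := isBigO_pi.2 fun c => IsBigO.of_bound 1
    (Eventually.of_forall fun x => by
      rw [one_mul]
      exact norm_le_pi_norm (δ x) (.inr c))
  have hy : ∀ s, (fun x => ofLp (gam x s) - ofLp (arm.gamma s) - N s *ᵥ z s x) =o[l] z s :=
    fun s => isLittleO_leastSquares (harm.C_posDef s) (harm.fit_exact s) (harm.gamma_interior s)
      (harm.G_smooth s) (harm.gram_nonsingular s) (hmin s) (hgam s)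
  have hy' : ∀ s, (fun x => ofLp (gam x s) - ofLp (arm.gamma s)) =O[l] z s := fun s =>
    ((hy s).isBigO.add (isBigO_mulVec (N s) (z s))).congr_left fun x => by abel
  have hsmooth := harm.contDiffAt_extrapolant
  -- The chain rule: the derivative of the extrapolant composed with the expansion of the least
  -- squares fit.
  have hg : ∀ s, (fun x => g s x - (J s * N s) *ᵥ z s x) =o[l] δ := fun s => by
    have h1 := (isLittleO_sub_jacobian_mulVec (f := fun y i => pr.G (-1) y i) (hsmooth s)
      (hgam s)).trans_isBigO (hy' s)
    have h2 := (isBigO_mulVec (J s) _).trans_isLittleO (hy s)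
    refine ((h1.add h2).trans_isBigO (hz s)).congr_left fun x => ?_
    rw [mulVec_sub (J s) (ofLp (gam x s) - ofLp (arm.gamma s)) (N s *ᵥ z s x), mulVec_mulVec]
    exact sub_add_sub_cancel _ _ _
  have hg0 : ∀ s i, Tendsto (fun x => g s x i) l (𝓝 0) := fun s i => by
    have h1 := ((hsmooth s i).continuousAt.tendsto.comp (hgam s)).sub_const
      (pr.G (-1) (arm.gamma s) i)
    rwa [sub_self] at h1
  -- The weight error is `O(δ)` and the error of the extrapolated value tends to zero, so their
  -- product is negligible.
  have hcross : ∀ s, (fun x => (a x s - a₀ s) • g s x) =o[l] δ := fun s => by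
    refine isLittleO_pi.2 fun i => ?_
    have h1 : (fun x => a x s - a₀ s) =O[l] δ := by
      simp only [ha]
      exact (isBigO_pi.1 (isBigO_mulVec Da ζ) s).trans hζ
    have h2 := h1.norm_right.mul_isLittleO ((isLittleO_one_iff ℝ).2 (hg0 s i))
    simpa using h2
  -- The increment of a product `a G` is `a₀ ΔG + Δa ΔG + Δa G₀`. The last term is exactly linear in
  -- the error of `ξ̂` and is the contribution of `weightTerm`, so only the first two leave
  -- remainders.
  have hsum : (fun x => ∑ s, (a₀ s • (g s x - (J s * N s) *ᵥ z s x) +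
      (a x s - a₀ s) • g s x)) =o[l] δ :=
    IsLittleO.fun_sum fun s _ => ((hg s).const_smul_left (a₀ s)).add (hcross s)
  refine hsum.congr_left fun x => ?_
  funext i
  have hT : (weightTerm pr Da arm.gamma *ᵥ (ofLp (xi x) - ofLp pr.xi)) i =
      ∑ s, pr.G (-1) (arm.gamma s) i * (a x s - a₀ s) := by
    simp only [ha, mulVec, dotProduct, weightTerm, of_apply, Finset.sum_mul, Finset.mul_sum]
    rw [Finset.sum_comm]
    exact Finset.sum_congr rfl fun s _ => Finset.sum_congr rfl fun c _ => by ring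
  have hD : ∀ s, ∑ j : Fin R × Fin d, extrapolationMatrix pr arm.C a₀ arm.gamma i (j, s) *
      (theta x s j.1 j.2 - arm.theta s j.1 j.2) = a₀ s * ((J s * N s) *ᵥ z s x) i := fun s => by
    simp only [extrapolationMatrix_apply harm.C_posDef harm.gram_nonsingular, mulVec, dotProduct,
      Finset.mul_sum]
    exact Finset.sum_congr rfl fun j _ => mul_assoc _ _ _
  rw [Pi.sub_apply, fromCols_mulVec_stack_sub, hT]
  simp only [hD]
  have hE : ∀ (b : S → ℝ) (γ : S → Vec m), ofLp (extrapolate pr b γ) i =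
      ∑ s, b s * pr.G (-1) (γ s) i := fun b γ => by
    simp [extrapolate, Finset.sum_apply]
  rw [Pi.sub_apply, hE, hE, Finset.sum_apply, ← Finset.sum_sub_distrib, ← Finset.sum_add_distrib,
    ← Finset.sum_sub_distrib]
  refine Finset.sum_congr rfl fun s _ => ?_
  simp only [Pi.add_apply, Pi.smul_apply, Pi.sub_apply, smul_eq_mul, g]
  ring

end Extrapolation

/-! ### Asymptotics of the simulation-extrapolation estimators -/

section Asymptotics

variable {𝒴 𝒵 κ S Ω : Type*} [MeasurableSpace 𝒴] [MeasurableSpace 𝒵] [MeasurableSpace Ω]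
  {k p d m R B : ℕ} [Fintype S] [DecidableEq S] [Fintype κ] [DecidableEq κ]
  {pr : Problem 𝒴 𝒵 k p d m R κ} {arm : Arm S k p d m R κ} {μ : Measure Ω}
  {w : ℕ → Ω → Aug 𝒴 𝒵 k p B S} {est : Estimators Ω S k p d m R B κ}

theorem IsSample.isIID (hs : IsSample μ pr w) : IsIID μ (augLaw pr B) w :=
  ⟨hs.measurable, hs.indep, hs.law⟩

theorem sampleMean_apply {V ι : Type*} {w : ℕ → Ω → V} (h : V → EuclideanSpace ℝ ι) (i : ι)
    (x : ℕ × Ω) : sampleMean w h x i = sampleMean w (fun v => h v i) x := by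
  simp [sampleMean]

theorem tendsto_stack {X : Type*} {l : Filter X} {theta : X → S → Fin R → Vec d}
    {theta₀ : S → Fin R → Vec d} {xi : X → Corr k p κ} {xi₀ : Corr k p κ}
    (hθ : ∀ s r, Tendsto (fun x => theta x s r) l (𝓝 (theta₀ s r)))
    (hξ : Tendsto xi l (𝓝 xi₀)) :
    Tendsto (fun x => stack (theta x) (xi x)) l (𝓝 (stack theta₀ xi₀)) := by
  refine ((PiLp.continuous_toLp 2 fun _ : StackIdx S k p d R κ => ℝ).tendsto _).comp
    (tendsto_pi_nhds.2 fun i => ?_)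
  rcases i with i | c
  · exact ((EuclideanSpace.proj i.1.2 : Vec d →L[ℝ] ℝ).continuous.tendsto _).comp
      (hθ i.2 i.1.1)
  · exact ((EuclideanSpace.proj c : Corr k p κ →L[ℝ] ℝ).continuous.tendsto _).comp hξ

variable [IsProbabilityMeasure μ] [IsProbabilityMeasure pr.P]

theorem tendsto_xi (hpr : pr.Regular) (hs : IsSample μ pr w) (hfit : IsSimexFit μ pr arm w est) :
    Tendsto (fun x : ℕ × Ω => est.xi x.1 x.2) (inProb μ) (𝓝 pr.xi) := by
  have hroot := hfit.xi_solves.eventually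
  refine tendsto_of_unique_clusterPt hpr.xiSet_compact (hroot.mono fun x hx => hx.1)
    fun e he l' hl' _ hlim => hpr.xi_unique e he ?_
  exact hpr.g_regular.integral_eq_zero_of_tendsto (hs.isIID.comp measurePreserving_obs) hl' he
    hlim (hl' (hroot.mono fun x hx => hx.1)) (hl' (hroot.mono fun x hx => hx.2))

/-- Plugging in `ξ̂` costs nothing: a limit point `e` of the root and the limit of `ξ̂` give one
joint limit in the product of the parameter spaces, and `e` then solves the population equation at
the true `ξ`. -/
theorem tendsto_theta (hpr : pr.Regular) (harm : arm.Regular pr B) (hs : IsSample μ pr w)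
    (hfit : IsSimexFit μ pr arm w est) (b : Fin B) (s : S) (r : Fin R) :
    Tendsto (fun x : ℕ × Ω => est.theta x.1 b s r x.2) (inProb μ) (𝓝 (arm.theta s r)) := by
  have hroot := (hfit.theta_solves b s r).eventually
  have hxi := hfit.xi_solves.eventually
  refine tendsto_of_unique_clusterPt hpr.thetaSet_compact (hroot.mono fun x hx => hx.1)
    fun e he l' hl' _ hlim => harm.theta_unique s r e he ?_
  exact (harm.score_regular s r).integral_eq_zero_of_tendsto
    (hs.isIID.comp (measurePreserving_replicate b s)) hl'
    (Set.mk_mem_prod he (interior_subset hpr.g_regular.mem_interior))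
    (hlim.prodMk_nhds ((tendsto_xi hpr hs hfit).mono_left hl'))
    (hl' ((hroot.and hxi).mono fun x hx => Set.mk_mem_prod hx.1.1 hx.2.1))
    (hl' (hroot.mono fun x hx => hx.2))

theorem tendsto_thetaBar (hB : 0 < B) (hpr : pr.Regular) (harm : arm.Regular pr B)
    (hs : IsSample μ pr w) (hfit : IsSimexFit μ pr arm w est) (s : S) (r : Fin R) :
    Tendsto (fun x : ℕ × Ω => est.thetaBar x.1 x.2 s r) (inProb μ) (𝓝 (arm.theta s r)) := by
  have hB' : (B : ℝ) ≠ 0 := by positivity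
  have h := (tendsto_finsetSum Finset.univ fun b _ =>
    tendsto_theta hpr harm hs hfit b s r).const_smul (B : ℝ)⁻¹
  rw [Finset.sum_const, Finset.card_univ, Fintype.card_fin, ← Nat.cast_smul_eq_nsmul ℝ,
    smul_smul, inv_mul_cancel₀ hB', one_smul] at h
  exact h

theorem tendsto_gamma (hB : 0 < B) (hpr : pr.Regular) (harm : arm.Regular pr B)
    (hs : IsSample μ pr w) (hfit : IsSimexFit μ pr arm w est) (s : S) :
    Tendsto (fun x : ℕ × Ω => est.gamma x.1 s x.2) (inProb μ) (𝓝 (arm.gamma s)) :=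
  tendsto_leastSquares (harm.C_posDef s) (harm.fit_exact s)
    (interior_subset (harm.gamma_interior s)) (harm.gamma_separated s)
    (tendsto_thetaBar hB hpr harm hs hfit s) (hfit.gamma_minimizes s).eventually

theorem tendsto_breadHat (hB : 0 < B) (hpr : pr.Regular) (harm : arm.Regular pr B)
    (hs : IsSample μ pr w) (hfit : IsSimexFit μ pr arm w est) :
    Tendsto (fun x : ℕ × Ω => breadHat pr arm w est x.1 x.2) (inProb μ)
      (𝓝 (breadMatrix pr arm B)) := by
  refine tendsto_pi_nhds.2 fun i => tendsto_pi_nhds.2 fun c => ?_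
  have h1 := (locallyRegular_stackedScore hB hpr harm i).tendsto_sampleMean_fderiv hs.isIID
    (tendsto_stack (tendsto_thetaBar hB hpr harm hs hfit) (tendsto_xi hpr hs hfit))
  have h2 := ((ContinuousLinearMap.apply ℝ ℝ (EuclideanSpace.single c (1 : ℝ))).continuous.tendsto
    _).comp h1
  rw [ContinuousLinearMap.apply_apply, ← breadMatrix_apply hB hpr harm] at h2
  refine h2.congr fun x => ?_
  simp [breadHat, sampleMean, Matrix.sum_apply, jacobian]

theorem tendsto_meatHat (hB : 0 < B) (hpr : pr.Regular) (harm : arm.Regular pr B)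
    (hs : IsSample μ pr w) (hfit : IsSimexFit μ pr arm w est) :
    Tendsto (fun x : ℕ × Ω => meatHat pr arm w est x.1 x.2) (inProb μ)
      (𝓝 (meatMatrix pr arm B)) := by
  refine tendsto_pi_nhds.2 fun i => tendsto_pi_nhds.2 fun c => ?_
  have h1 := (locallyRegular_stackedScore hB hpr harm i).tendsto_sampleMean_mul
    (locallyRegular_stackedScore hB hpr harm c) hs.isIID
    (tendsto_stack (tendsto_thetaBar hB hpr harm hs hfit) (tendsto_xi hpr hs hfit))
  refine h1.congr fun x => ?_
  simp [meatHat, sampleMean, Matrix.sum_apply, vecMulVec_apply]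

/-- The stacked estimators of one replicate are asymptotically linear. -/
theorem isLittleO_replicate (hB : 0 < B) (hpr : pr.Regular) (harm : arm.Regular pr B)
    (hs : IsSample μ pr w) (hfit : IsSimexFit μ pr arm w est) (b : Fin B) :
    (fun x : ℕ × Ω => ofLp (stack (fun s r => est.theta x.1 b s r x.2) (est.xi x.1 x.2)) -
        ofLp (stack arm.theta pr.xi) - -((breadMatrix pr arm B)⁻¹ *ᵥ fun i =>
          sampleMean w (fun v => replicateScore pr arm b v (stack arm.theta pr.xi) i) x))
      =o[inProb μ] fun x i =>
        sampleMean w (fun v => replicateScore pr arm b v (stack arm.theta pr.xi) i) x := by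
  set e₀ := stack arm.theta pr.xi with he₀
  set θ : ℕ × Ω → EuclideanSpace ℝ (StackIdx S k p d R κ) := fun x =>
    stack (fun s r => est.theta x.1 b s r x.2) (est.xi x.1 x.2) with hθ
  set u : ℕ × Ω → StackIdx S k p d R κ → ℝ := fun x i =>
    sampleMean w (fun v => replicateScore pr arm b v e₀ i) x with hu
  set A := breadMatrix pr arm B with hA
  have hlim : Tendsto θ (inProb μ) (𝓝 e₀) :=
    tendsto_stack (fun s r => tendsto_theta hpr harm hs hfit b s r) (tendsto_xi hpr hs hfit)
  -- One replicate together with `ξ̂` is a joint root of the stacked equations of that replicate.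
  have hroot : ∀ᶠ x in inProb μ, ∀ i,
      sampleMean w (fun v => replicateScore pr arm b v (θ x) i) x = 0 := by
    refine eventually_all.2 fun i => ?_
    rcases i with i | c
    · filter_upwards [(hfit.theta_solves b i.2 i.1.1).eventually] with x hx
      have h1 := congrArg (fun t : Vec d => t i.1.2) hx.2
      exact (sampleMean_apply (w := w) (fun v => score pr arm i.2 i.1.1 (v.1, v.2 b i.2)
        (est.theta x.1 b i.2 i.1.1 x.2, est.xi x.1 x.2)) i.1.2 x).symm.trans h1
    · filter_upwards [hfit.xi_solves.eventually] with x hx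
      have h1 := congrArg (fun t : Corr k p κ => t c) hx.2
      exact (sampleMean_apply (w := w) (fun v => pr.g v.1 (est.xi x.1 x.2)) c x).symm.trans h1
  have hnorm : (fun x => θ x - e₀) =O[inProb μ] fun x => ofLp (θ x) - ofLp e₀ :=
    ((PiLp.continuousLinearEquiv 2 ℝ (fun _ : StackIdx S k p d R κ => ℝ)).symm :
      (StackIdx S k p d R κ → ℝ) →L[ℝ] EuclideanSpace ℝ (StackIdx S k p d R κ)).isBigO_comp
        (fun x => ofLp (θ x) - ofLp e₀) (inProb μ)
  have hlin : (fun x => -u x - A *ᵥ (ofLp (θ x) - ofLp e₀)) =o[inProb μ]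
      fun x => ofLp (θ x) - ofLp e₀ := by
    refine isLittleO_pi.2 fun i => ?_
    have h1 := ((locallyRegular_replicateScore hpr harm b i).isLittleO_sampleMean_sub hs.isIID
      hlim).trans_isBigO hnorm
    refine h1.congr' ?_ EventuallyEq.rfl
    filter_upwards [hroot] with x hx
    rw [hx i, zero_sub, Pi.sub_apply, hA, breadMatrix_mulVec hB hpr harm b]
    rfl
  -- The linearization error is relative to the estimation error itself; after multiplication by
  -- `A⁻¹` it is absorbed.
  refine isLittleO_sub_of_isLittleO_add ((isBigO_mulVec A⁻¹ u).neg_left) ?_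
  have hle : (fun x => ofLp (θ x) - ofLp e₀) =O[inProb μ]
      fun x => ‖u x‖ + ‖ofLp (θ x) - ofLp e₀‖ := IsBigO.of_bound 1
    (Eventually.of_forall fun x => by
      rw [one_mul, Real.norm_of_nonneg (by positivity)]
      exact le_add_of_nonneg_left (norm_nonneg _))
  refine (((isBigO_mulVec A⁻¹ _).trans_isLittleO (hlin.trans_isBigO hle)).neg_left).congr_left
    fun x => ?_
  rw [mulVec_sub, mulVec_mulVec, nonsing_inv_mul _ harm.bread_nonsingular, one_mulVec,
    mulVec_neg]
  abel

/-- The sample means of the replicated scores at the population value. -/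
def replicateMeans (pr : Problem 𝒴 𝒵 k p d m R κ) (arm : Arm S k p d m R κ)
    (w : ℕ → Ω → Aug 𝒴 𝒵 k p B S) (x : ℕ × Ω) :
    EuclideanSpace ℝ (Fin B × StackIdx S k p d R κ) :=
  toLp 2 fun j => sampleMean w
    (fun v => replicateScore pr arm j.1 v (stack arm.theta pr.xi) j.2) x

/-- The sample mean of the stacked score at the population value. -/
def stackedMean (pr : Problem 𝒴 𝒵 k p d m R κ) (arm : Arm S k p d m R κ)
    (w : ℕ → Ω → Aug 𝒴 𝒵 k p B S) (x : ℕ × Ω) : StackIdx S k p d R κ → ℝ :=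
  fun i => sampleMean w (fun v => stackedScore pr arm v (stack arm.theta pr.xi) i) x

/-- The joint vector over all replicates is the common yardstick for remainders. The averaged score
would not do, since cancellation can make it smaller than the individual ones. -/
theorem isBigO_replicateMeans (b : Fin B) :
    (fun (x : ℕ × Ω) i =>
      sampleMean w (fun v => replicateScore pr arm b v (stack arm.theta pr.xi) i) x)
      =O[inProb μ] replicateMeans pr arm w :=
  isBigO_pi.2 fun i => IsBigO.of_bound 1 (Eventually.of_forall fun x => by
    rw [one_mul]
    exact PiLp.norm_apply_le (replicateMeans pr arm w x) (b, i))

theorem stackedMean_eq_average (hB : 0 < B) (x : ℕ × Ω) :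
    stackedMean pr arm w x = (B : ℝ)⁻¹ • ∑ b, fun i =>
      sampleMean w (fun v => replicateScore pr arm b v (stack arm.theta pr.xi) i) x := by
  funext i
  simp only [stackedMean, stackedScore_eq_average hB, Pi.smul_apply, Finset.sum_apply, sampleMean,
    smul_eq_mul, Finset.mul_sum]
  rw [Finset.sum_comm]
  exact Finset.sum_congr rfl fun b _ => Finset.sum_congr rfl fun i _ => by ring

theorem isBigO_stackedMean (hB : 0 < B) :
    stackedMean pr arm w =O[inProb μ] replicateMeans pr arm w := by
  have h := (IsBigO.fun_sum (s := Finset.univ) fun b _ =>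
    isBigO_replicateMeans (μ := μ) (pr := pr) (arm := arm) (w := w) b).const_smul_left (B : ℝ)⁻¹
  exact h.congr_left fun x => (stackedMean_eq_average hB x).symm

/-- The stacked estimators, averaged over the replicates, are asymptotically linear. -/
theorem isLittleO_stack (hB : 0 < B) (hpr : pr.Regular) (harm : arm.Regular pr B)
    (hs : IsSample μ pr w) (hfit : IsSimexFit μ pr arm w est) :
    (fun x : ℕ × Ω => ofLp (stack (est.thetaBar x.1 x.2) (est.xi x.1 x.2)) -
        ofLp (stack arm.theta pr.xi) + (breadMatrix pr arm B)⁻¹ *ᵥ stackedMean pr arm w x)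
      =o[inProb μ] replicateMeans pr arm w := by
  have hB' : (B : ℝ) ≠ 0 := by positivity
  have h := (IsLittleO.fun_sum (s := Finset.univ) fun b _ => (isLittleO_replicate hB hpr harm hs
    hfit b).trans_isBigO (isBigO_replicateMeans b)).const_smul_left (B : ℝ)⁻¹
  refine h.congr_left fun x => ?_
  simp only [sub_neg_eq_add, Pi.smul_apply]
  rw [Finset.sum_add_distrib, Finset.sum_sub_distrib, Finset.sum_const, Finset.card_univ,
    Fintype.card_fin, smul_add, smul_sub, ← Nat.cast_smul_eq_nsmul ℝ, smul_smul,
    inv_mul_cancel₀ hB', one_smul, ← mulVec_sum, ← mulVec_smul, stackedMean_eq_average hB]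
  congr 2
  funext i
  -- For `Θ` this is the definition of the replicate average; for `ξ` all replicates share `ξ̂`, and
  -- averaging returns it.
  rcases i with i | c
  · simp [stack, Estimators.thetaBar, Finset.sum_apply]
  · simp [stack, Finset.sum_apply, hB']

theorem boundedInProb_replicateMeans (hpr : pr.Regular) (harm : arm.Regular pr B)
    (hs : IsSample μ pr w) :
    BoundedInProb μ fun (n : ℕ) ω => √(n : ℝ) • replicateMeans pr arm w (n, ω) := by
  have h := hs.isIID.boundedInProb_sqrt_mul_sampleMean
    (h := fun (j : Fin B × StackIdx S k p d R κ) v =>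
      replicateScore pr arm j.1 v (stack arm.theta pr.xi) j.2)
    (fun j => (locallyRegular_replicateScore hpr harm j.1 j.2).measurable _)
    (fun j => (locallyRegular_replicateScore hpr harm j.1 j.2).memLp)
    fun j => integral_replicateScore hpr harm j.1 j.2
  exact h

theorem posSemidef_meatMatrix (hB : 0 < B) (hpr : pr.Regular) (harm : arm.Regular pr B) :
    (meatMatrix pr arm B).PosSemidef :=
  posSemidef_secondMoment fun i => (locallyRegular_stackedScore hB hpr harm i).memLp

/-- The form `N M Nᵀ` with `N = [D T] A⁻¹` shows positive semidefiniteness and is the covariance of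
the linear image of the score under `N`. -/
theorem sandwich_eq (D : Matrix (Fin d) ((Fin R × Fin d) × S) ℝ)
    (T : Matrix (Fin d) (CorrIdx k p κ) ℝ)
    (A M : Matrix (StackIdx S k p d R κ) (StackIdx S k p d R κ) ℝ) :
    sandwich D T A M = (fromCols D T * A⁻¹) * M * (fromCols D T * A⁻¹)ᵀ := by
  rw [sandwich, transpose_mul, ← Matrix.mul_assoc]

theorem integral_stackedScore (hB : 0 < B) (hpr : pr.Regular) (harm : arm.Regular pr B)
    (i : StackIdx S k p d R κ) :
    ∫ v, stackedScore pr arm v (stack arm.theta pr.xi) i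
      ∂(augLaw pr B : Measure (Aug 𝒴 𝒵 k p B S)) = 0 := by
  simp only [stackedScore_eq_average hB]
  rw [integral_const_mul, integral_finsetSum _ fun b _ =>
    (locallyRegular_replicateScore hpr harm b i).memLp.integrable (by norm_num)]
  simp [integral_replicateScore hpr harm]

/-- The central limit theorem for linear images of the stacked score. -/
theorem tendstoInDistribution_stackedScore (hB : 0 < B) (hpr : pr.Regular)
    (harm : arm.Regular pr B) (hs : IsSample μ pr w)
    (N : Matrix (Fin d) (StackIdx S k p d R κ) ℝ) :
    TendstoInDistribution (fun (n : ℕ) ω => √(n : ℝ) • sampleMean w (fun v =>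
        (toLp 2 (-(N *ᵥ stackedScore pr arm v (stack arm.theta pr.xi))) : Vec d)) (n, ω)) atTop
      (id : Vec d → Vec d) (fun _ => μ)
      (multivariateGaussian 0 (N * meatMatrix pr arm B * Nᵀ)) := by
  have hreg := locallyRegular_stackedScore hB hpr harm
  have hdot : ∀ (t : Fin d → ℝ) (v : Aug 𝒴 𝒵 k p B S),
      t ⬝ᵥ -(N *ᵥ stackedScore pr arm v (stack arm.theta pr.xi)) =
        -((Nᵀ *ᵥ t) ⬝ᵥ stackedScore pr arm v (stack arm.theta pr.xi)) := fun t v => by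
    rw [dotProduct_neg, dotProduct_mulVec, mulVec_transpose]
  refine hs.isIID.tendstoInDistribution_sampleMean ?_ ?_ (fun t => ?_) ?_ fun t => ?_
  · refine (PiLp.continuous_toLp 2 fun _ : Fin d => ℝ).measurable.comp
      (measurable_pi_iff.2 fun i => Measurable.neg ?_)
    exact Finset.measurable_fun_sum _ fun j _ => ((hreg j).measurable _).const_mul _
  · refine MemLp.of_eval_piLp fun i => MemLp.neg ?_
    exact memLp_finsetSum _ fun j _ => (hreg j).memLp.const_mul _
  · simp only [hdot]
    rw [integral_neg, neg_eq_zero]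
    simp only [dotProduct]
    rw [integral_finsetSum _ fun j _ => ((hreg j).memLp.integrable (by norm_num)).const_mul _]
    simp only [integral_const_mul, integral_stackedScore hB hpr harm, mul_zero,
      Finset.sum_const_zero]
  · simpa using (posSemidef_meatMatrix hB hpr harm).mul_mul_conjTranspose_same N
  · simp only [hdot, neg_sq]
    rw [← dotProduct_secondMoment_mulVec fun i => (hreg i).memLp, ← mulVec_mulVec,
      ← mulVec_mulVec, dotProduct_mulVec, ← mulVec_transpose]
    rfl

theorem sampleMean_toLp_neg_mulVec (N : Matrix (Fin d) (StackIdx S k p d R κ) ℝ) (x : ℕ × Ω) :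
    sampleMean w (fun v =>
      (toLp 2 (-(N *ᵥ stackedScore pr arm v (stack arm.theta pr.xi))) : Vec d)) x =
      toLp 2 (-(N *ᵥ stackedMean pr arm w x)) := by
  ext i
  rw [sampleMean_apply]
  simp only [sampleMean, stackedMean, Pi.neg_apply, mulVec, dotProduct, smul_eq_mul,
    Finset.sum_neg_distrib, mul_neg, Finset.mul_sum]
  rw [Finset.sum_comm]
  exact congrArg _ (Finset.sum_congr rfl fun j _ => Finset.sum_congr rfl fun i _ => by ring)

/-- The extrapolated estimators are asymptotically linear. -/
theorem isLittleO_extrapolate_sub_sampleMean (hB : 0 < B) (hpr : pr.Regular)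
    (harm : arm.Regular pr B) (hs : IsSample μ pr w) (hfit : IsSimexFit μ pr arm w est)
    {a : Corr k p κ → S → ℝ} {Da : Matrix S (CorrIdx k p κ) ℝ}
    (ha : ∀ x s, a x s - a pr.xi s = (Da *ᵥ (ofLp x - ofLp pr.xi)) s)
    {N : Matrix (Fin d) (StackIdx S k p d R κ) ℝ}
    (hN : N = fromCols (extrapolationMatrix pr arm.C (a pr.xi) arm.gamma)
      (weightTerm pr Da arm.gamma) * (breadMatrix pr arm B)⁻¹) :
    (fun x : ℕ × Ω => (extrapolate pr (a (est.xi x.1 x.2)) fun s => est.gamma x.1 s x.2) -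
      extrapolate pr (a pr.xi) arm.gamma - sampleMean w (fun v =>
        (toLp 2 (-(N *ᵥ stackedScore pr arm v (stack arm.theta pr.xi))) : Vec d)) x)
      =o[inProb μ] replicateMeans pr arm w := by
  have hstack := isLittleO_stack hB hpr harm hs hfit
  have hext := isLittleO_extrapolate (l := inProb μ) (X := ℕ × Ω) harm
    (theta := fun x => est.thetaBar x.1 x.2) (xi := fun x => est.xi x.1 x.2)
    (gam := fun x s => est.gamma x.1 s x.2) (a := fun x => a (est.xi x.1 x.2))
    (a₀ := a pr.xi) (Da := Da) (fun x s => ha _ s)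
    (fun s => (hfit.gamma_minimizes s).eventually) (tendsto_gamma hB hpr harm hs hfit)
  -- The stacked error is itself of the order of the yardstick, so the remainder of the
  -- extrapolation step can be measured against it too.
  have hO : (fun x : ℕ × Ω => ofLp (stack (est.thetaBar x.1 x.2) (est.xi x.1 x.2)) -
      ofLp (stack arm.theta pr.xi)) =O[inProb μ] replicateMeans pr arm w :=
    (hstack.isBigO.sub ((isBigO_mulVec (breadMatrix pr arm B)⁻¹ _).trans
      (isBigO_stackedMean hB))).congr_left fun x => add_sub_cancel_right _ _
  have hlin := (hext.trans_isBigO hO).add ((isBigO_mulVec (fromCols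
    (extrapolationMatrix pr arm.C (a pr.xi) arm.gamma) (weightTerm pr Da arm.gamma))
      _).trans_isLittleO hstack)
  refine ((((PiLp.continuousLinearEquiv 2 ℝ (fun _ : Fin d => ℝ)).symm :
    (Fin d → ℝ) →L[ℝ] Vec d).isBigO_comp _ (inProb μ)).trans_isLittleO hlin).congr_left
      fun x => ?_
  rw [sampleMean_toLp_neg_mulVec, mulVec_add, ← add_assoc, sub_add_cancel, mulVec_mulVec, ← hN]
  simp only [toLp_neg, sub_neg_eq_add]
  rfl

/-- Asymptotic normality of the extrapolated estimators. -/
theorem tendstoInDistribution_extrapolate (hB : 0 < B) (hpr : pr.Regular)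
    (harm : arm.Regular pr B) (hs : IsSample μ pr w) (hfit : IsSimexFit μ pr arm w est)
    {a : Corr k p κ → S → ℝ} (hac : Continuous a) {Da : Matrix S (CorrIdx k p κ) ℝ}
    (ha : ∀ x s, a x s - a pr.xi s = (Da *ᵥ (ofLp x - ofLp pr.xi)) s)
    {N : Matrix (Fin d) (StackIdx S k p d R κ) ℝ}
    (hN : N = fromCols (extrapolationMatrix pr arm.C (a pr.xi) arm.gamma)
      (weightTerm pr Da arm.gamma) * (breadMatrix pr arm B)⁻¹) :
    TendstoInDistribution (fun (n : ℕ) ω => √(n : ℝ) •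
        ((extrapolate pr (a (est.xi n ω)) fun s => est.gamma n s ω) -
          extrapolate pr (a pr.xi) arm.gamma)) atTop
      (id : Vec d → Vec d) (fun _ => μ)
      (multivariateGaussian 0 (N * meatMatrix pr arm B * Nᵀ)) := by
  refine tendstoInDistribution_of_tendstoInMeasure_sub (fun (n : ℕ) ω => √(n : ℝ) •
    ((extrapolate pr (a (est.xi n ω)) fun s => est.gamma n s ω) -
      extrapolate pr (a pr.xi) arm.gamma)) id
    (tendstoInDistribution_stackedScore hB hpr harm hs N) ?_ fun n => ?_
  -- The yardstick is bounded in probability at rate `√n`, so the remainder times `√n` vanishes and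
  -- the limit law is that of the linear term.
  · have hlim := (boundedInProb_replicateMeans hpr harm hs).tendsto_smul
      (isLittleO_extrapolate_sub_sampleMean hB hpr harm hs hfit ha hN)
    refine (tendsto_inProb_iff (c := (0 : Vec d))).1 (hlim.congr fun x => ?_)
    rw [smul_sub]
    rfl
  · refine (Measurable.const_smul (Measurable.sub_const ?_ _) (√(n : ℝ))).aemeasurable
    exact Finset.measurable_fun_sum _ fun s _ =>
      ((measurable_pi_apply s).comp (hac.measurable.comp (hfit.xi_measurable n))).smul
        (hpr.G_measurable.comp (hfit.gamma_measurable n s))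

theorem tendsto_fromCols {X : Type*} {l : Filter X}
    {D : X → Matrix (Fin d) ((Fin R × Fin d) × S) ℝ} {D₀ : Matrix (Fin d) ((Fin R × Fin d) × S) ℝ}
    {T : X → Matrix (Fin d) (CorrIdx k p κ) ℝ} {T₀ : Matrix (Fin d) (CorrIdx k p κ) ℝ}
    (hD : Tendsto D l (𝓝 D₀)) (hT : Tendsto T l (𝓝 T₀)) :
    Tendsto (fun x => fromCols (D x) (T x)) l (𝓝 (fromCols D₀ T₀)) := by
  refine tendsto_pi_nhds.2 fun i => tendsto_pi_nhds.2 fun c => ?_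
  rcases c with c | c
  · exact tendsto_pi_nhds.1 (tendsto_pi_nhds.1 hD i) c
  · exact tendsto_pi_nhds.1 (tendsto_pi_nhds.1 hT i) c

theorem tendsto_sandwich {X : Type*} {l : Filter X}
    {D : X → Matrix (Fin d) ((Fin R × Fin d) × S) ℝ} {D₀ : Matrix (Fin d) ((Fin R × Fin d) × S) ℝ}
    {T : X → Matrix (Fin d) (CorrIdx k p κ) ℝ} {T₀ : Matrix (Fin d) (CorrIdx k p κ) ℝ}
    {A M : X → Matrix (StackIdx S k p d R κ) (StackIdx S k p d R κ) ℝ}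
    {A₀ M₀ : Matrix (StackIdx S k p d R κ) (StackIdx S k p d R κ) ℝ}
    (hD : Tendsto D l (𝓝 D₀)) (hT : Tendsto T l (𝓝 T₀)) (hA₀ : IsUnit A₀.det)
    (hA : Tendsto A l (𝓝 A₀)) (hM : Tendsto M l (𝓝 M₀)) :
    Tendsto (fun x => sandwich (D x) (T x) (A x) (M x)) l (𝓝 (sandwich D₀ T₀ A₀ M₀)) := by
  simp only [sandwich_eq]
  have h := tendsto_matrix_mul (tendsto_fromCols hD hT) (tendsto_matrix_inv hA₀ hA)
  exact tendsto_matrix_mul (tendsto_matrix_mul h hM) (tendsto_matrix_transpose h)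

/-- Consistency, asymptotic normality and consistency of the sandwich estimator, for weights that
are affine functions of the correction parameters. -/
theorem consistentAsymptoticallyNormal_extrapolate (hB : 0 < B) (hpr : pr.Regular)
    (harm : arm.Regular pr B) (hs : IsSample μ pr w) (hfit : IsSimexFit μ pr arm w est)
    (a : Corr k p κ → S → ℝ) (Da : Matrix S (CorrIdx k p κ) ℝ)
    (ha : ∀ x s, a x s - a pr.xi s = (Da *ᵥ (ofLp x - ofLp pr.xi)) s) :
    ConsistentAsymptoticallyNormal μ
      (fun n ω => extrapolate pr (a (est.xi n ω)) fun s => est.gamma n s ω)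
      (extrapolate pr (a pr.xi) arm.gamma)
      (sandwich (extrapolationMatrix pr arm.C (a pr.xi) arm.gamma) (weightTerm pr Da arm.gamma)
        (breadMatrix pr arm B) (meatMatrix pr arm B))
      (fun n ω => sandwich
        (extrapolationMatrix pr arm.C (a (est.xi n ω)) fun s => est.gamma n s ω)
        (weightTerm pr Da fun s => est.gamma n s ω)
        (breadHat pr arm w est n ω) (meatHat pr arm w est n ω)) := by
  have hgam := tendsto_gamma hB hpr harm hs hfit
  have hac : Continuous a := by
    refine continuous_pi fun s => ?_
    have h1 : (fun x => a x s) = fun x => a pr.xi s + (Da *ᵥ (ofLp x - ofLp pr.xi)) s :=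
      funext fun x => by rw [← ha]; ring
    have h2 : Continuous fun x : Corr k p κ => ofLp x := PiLp.continuous_ofLp 2 _
    have h3 : Continuous fun v : CorrIdx k p κ → ℝ => (Da *ᵥ (v - ofLp pr.xi)) s := by fun_prop
    rw [h1]
    exact continuous_const.add (h3.comp h2)
  have haT : Tendsto (fun x : ℕ × Ω => a (est.xi x.1 x.2)) (inProb μ) (𝓝 (a pr.xi)) :=
    (hac.tendsto _).comp (tendsto_xi hpr hs hfit)
  have hG : ∀ s, Tendsto (fun x : ℕ × Ω => pr.G (-1) (est.gamma x.1 s x.2)) (inProb μ)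
      (𝓝 (pr.G (-1) (arm.gamma s))) := fun s =>
    (harm.G_smooth_neg_one s).continuousAt.tendsto.comp (hgam s)
  have hT : Tendsto (fun x : ℕ × Ω => weightTerm pr Da fun s => est.gamma x.1 s x.2) (inProb μ)
      (𝓝 (weightTerm pr Da arm.gamma)) :=
    tendsto_pi_nhds.2 fun i => tendsto_pi_nhds.2 fun c => tendsto_finsetSum _ fun s _ =>
      (((EuclideanSpace.proj i : Vec d →L[ℝ] ℝ).continuous.tendsto _).comp (hG s)).mul_const _
  have hest : Tendsto (fun x : ℕ × Ω =>
      extrapolate pr (a (est.xi x.1 x.2)) fun s => est.gamma x.1 s x.2) (inProb μ)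
      (𝓝 (extrapolate pr (a pr.xi) arm.gamma)) :=
    tendsto_finsetSum _ fun s _ => (tendsto_pi_nhds.1 haT s).smul (hG s)
  have hV := tendsto_sandwich (tendsto_extrapolationMatrix harm haT hgam) hT
    harm.bread_nonsingular (tendsto_breadHat hB hpr harm hs hfit)
    (tendsto_meatHat hB hpr harm hs hfit)
  refine ⟨tendsto_inProb_iff.1 hest, ?_, ?_, fun i c => tendsto_inProb_iff.1
    (tendsto_pi_nhds.1 (tendsto_pi_nhds.1 hV i) c)⟩
  · rw [sandwich_eq]
    simpa using (posSemidef_meatMatrix hB hpr harm).mul_mul_conjTranspose_same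
      (fromCols (extrapolationMatrix pr arm.C (a pr.xi) arm.gamma) (weightTerm pr Da arm.gamma) *
        (breadMatrix pr arm B)⁻¹)
  · rw [sandwich_eq]
    exact tendstoInDistribution_extrapolate hB hpr harm hs hfit hac ha rfl

end Asymptotics

/-! ### Weights -/

section Weights

variable {𝒴 𝒵 κ S : Type*} [MeasurableSpace 𝒴] [MeasurableSpace 𝒵] {k p d m R : ℕ}
  (pr : Problem 𝒴 𝒵 k p d m R κ)

theorem weightTerm_zero [Fintype S] (gam : S → Vec m) :
    weightTerm pr (0 : Matrix S (CorrIdx k p κ) ℝ) gam = 0 := by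
  ext i c
  simp [weightTerm]

variable [DecidableEq κ]

/-- The derivative of the weights with respect to the correction parameters. -/
def weightSelector (k p : ℕ) (κ : Type*) [DecidableEq κ] : Matrix (Fin k) (CorrIdx k p κ) ℝ :=
  of fun j c => if c = .weight j then 1 else 0

theorem weightSelector_mulVec [Fintype κ] (v : CorrIdx k p κ → ℝ) (j : Fin k) :
    (weightSelector k p κ *ᵥ v) j = v (.weight j) := by
  simp [weightSelector, mulVec, dotProduct]

theorem weightTerm_weightSelector (gam : Fin k → Vec m) :
    weightTerm pr (weightSelector k p κ) gam = weightMatrix pr gam := by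
  ext i c
  cases c <;> simp [weightTerm, weightSelector, weightMatrix]

end Weights

end Simex

end

theorem theorem3 {𝒴 𝒵 κ Ω : Type*} [MeasurableSpace 𝒴] [MeasurableSpace 𝒵] [Fintype κ]
    [DecidableEq κ] [MeasurableSpace Ω] (μ : MeasureTheory.Measure Ω)
    [MeasureTheory.IsProbabilityMeasure μ] {k p d m R B : ℕ} (hB : 0 < B)
    (pr : Simex.Problem 𝒴 𝒵 k p d m R κ) [MeasureTheory.IsProbabilityMeasure pr.P]
    (hpr : pr.Regular) :
    -- averaging the proxies before extrapolation
    (∀ (arm : Simex.Arm Unit k p d m R κ) (w : ℕ → Ω → Simex.Aug 𝒴 𝒵 k p B Unit)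
        (est : Simex.Estimators Ω Unit k p d m R B κ),
      arm.sim = Simex.simulateMean → arm.Regular pr B → Simex.IsSample μ pr w →
      Simex.IsSimexFit μ pr arm w est →
      Simex.ConsistentAsymptoticallyNormal μ
        (fun n ω => pr.G (-1) (est.gamma n () ω))
        (pr.G (-1) (arm.gamma ()))
        (Simex.sandwich (Simex.extrapolationMatrix pr arm.C (fun _ => 1) arm.gamma) 0
          (Simex.breadMatrix pr arm B) (Simex.meatMatrix pr arm B))
        (fun n ω => Simex.sandwich
          (Simex.extrapolationMatrix pr arm.C (fun _ => 1) fun s => est.gamma n s ω) 0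
          (Simex.breadHat pr arm w est n ω) (Simex.meatHat pr arm w est n ω))) ∧
    -- averaging the estimates from the separate proxies after extrapolation
    (∀ (arm : Simex.Arm (Fin k) k p d m R κ) (w : ℕ → Ω → Simex.Aug 𝒴 𝒵 k p B (Fin k))
        (est : Simex.Estimators Ω (Fin k) k p d m R B κ),
      arm.sim = Simex.simulateEach → arm.Regular pr B → Simex.IsSample μ pr w →
      Simex.IsSimexFit μ pr arm w est →
      -- with prescribed weights
      (∀ a : Fin k → ℝ, Simex.ConsistentAsymptoticallyNormal μ
        (fun n ω => Simex.extrapolate pr a fun j => est.gamma n j ω)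
        (Simex.extrapolate pr a arm.gamma)
        (Simex.sandwich (Simex.extrapolationMatrix pr arm.C a arm.gamma) 0
          (Simex.breadMatrix pr arm B) (Simex.meatMatrix pr arm B))
        (fun n ω => Simex.sandwich
          (Simex.extrapolationMatrix pr arm.C a fun j => est.gamma n j ω) 0
          (Simex.breadHat pr arm w est n ω) (Simex.meatHat pr arm w est n ω))) ∧
      -- with estimated weights
      Simex.ConsistentAsymptoticallyNormal μ
        (fun n ω => Simex.extrapolate pr (Simex.weight (est.xi n ω)) fun j => est.gamma n j ω)
        (Simex.extrapolate pr (Simex.weight pr.xi) arm.gamma)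
        (Simex.sandwich (Simex.extrapolationMatrix pr arm.C (Simex.weight pr.xi) arm.gamma)
          (Simex.weightMatrix pr arm.gamma)
          (Simex.breadMatrix pr arm B) (Simex.meatMatrix pr arm B))
        (fun n ω => Simex.sandwich
          (Simex.extrapolationMatrix pr arm.C (Simex.weight (est.xi n ω)) fun j => est.gamma n j ω)
          (Simex.weightMatrix pr fun j => est.gamma n j ω)
          (Simex.breadHat pr arm w est n ω) (Simex.meatHat pr arm w est n ω))) := by
  refine ⟨fun arm w est _ harm hs hfit => ?_, fun arm w est _ harm hs hfit => ⟨fun a => ?_, ?_⟩⟩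
  -- A single series with weight one; the weight is constant in `ξ`, so its derivative is zero.
  · have h := Simex.consistentAsymptoticallyNormal_extrapolate hB hpr harm hs hfit
      (fun _ _ => 1) 0 (by simp)
    simpa only [Simex.weightTerm_zero, Simex.extrapolate, Finset.univ_unique, PUnit.default_eq_unit,
      Finset.sum_singleton, one_smul] using h
  · have h := Simex.consistentAsymptoticallyNormal_extrapolate hB hpr harm hs hfit
      (fun _ => a) 0 (by simp)
    simpa only [Simex.weightTerm_zero] using h
  -- The weights are coordinates of `ξ`, hence linear, with the coordinate selector as exact
  -- derivative.
  · have h := Simex.consistentAsymptoticallyNormal_extrapolate hB hpr harm hs hfit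
      Simex.weight (Simex.weightSelector k p κ) fun x j => by
        rw [Simex.weightSelector_mulVec]
        rfl
    simpa only [Simex.weightTerm_weightSelector] using h
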